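/- Let $n\ge 1$ and let $v_0\ge 0$ be a probability density on $\mathbb R^n$ with zero mean, finite second moment, and finite Shannon entropy: $$\int_{\mathbb R^n} v_0\,dx=1,\qquad \int_{\mathbb R^n} x\,v_0(x)\,dx=0,\qquad \int_{\mathbb R^n}|x|^2v_0(x)\,dx=E_0<\infty,\qquad v_0\log v_0\in L^1(\mathbb R^n).$$ For $\sigma>0$ let $M_\sigma(x)=(2\pi\sigma)^{-n/2}\exp\{-|x|^2/(2\sigma)\}$ and write $M=M_{E_0/n}$, the centred isotropic Gaussian density with second moment $E_0$. Let $v(x,t)$ and $M(x,t)$ be the solutions of the heat equation $\partial_t w=\Delta w$ on $\mathbb R^n\times(0,\infty)$ with initial values $v_0$ and $M$ respectively; here a solution is a function in $C([0,\infty);L^1(\mathbb R^n))$ that takes its initial value at $t=0$ and satisfies the equation classically for $t>0$ (it is $C^2$ in $x$ and differentiable in $t$, and $\Delta w$ is jointly continuous in $(x,t)$). For densities $f,g$ put $\mathcal H(f|g)=\int_{\mathbb R^n} f\log\frac{f}{g}\,dx$. Then for every $t\ge 0$ the function $v(t)\log\frac{v(t)}{M(t)}$ is integrable and $$\mathcal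 H(v(t)|M(t))\le -\frac n2\log\left[1-\left(1-\exp\left\{-\frac2n\,\mathcal H(v_0|M)\right\}\right)\frac{E_0}{E_0+2nt}\right],$$ and $\mathcal H(v(t)|M(t))\to 0$ as $t\to\infty$. -/

import Mathlib

open MeasureTheory Filter Topology Set

noncomputable section

/-- `f` is a probability density on `ℝⁿ` with zero mean and finite second moment `E₀`. -/
structure IsNormalizedDensity {n : ℕ} (f : EuclideanSpace ℝ (Fin n) → ℝ) (E₀ : ℝ) : Prop where
  nonneg : ∀ᵐ x, 0 ≤ f x
  integrable : Integrable f
  mass_eq_one : ∫ x, f x = 1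
  mean_eq_zero : ∫ x, f x • x = 0
  integrable_second_moment : Integrable (fun x => ‖x‖ ^ 2 * f x)
  second_moment_eq : ∫ x, ‖x‖ ^ 2 * f x = E₀

/-- The Shannon entropy `-∫ f log f` of `f` is well defined and finite. -/
def HasFiniteEntropy {n : ℕ} (f : EuclideanSpace ℝ (Fin n) → ℝ) : Prop :=
  Integrable (fun x => f x * Real.log (f x))

/-- The integrand of the relative Shannon entropy of `f` with respect to `g`. -/
def relEntropyIntegrand {n : ℕ} (f g : EuclideanSpace ℝ (Fin n) → ℝ) :
    EuclideanSpace ℝ (Fin n) → ℝ :=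
  fun x => f x * Real.log (f x / g x)

/-- The relative Shannon entropy `H(f|g) = ∫ f log (f / g)`. -/
def relEntropy {n : ℕ} (f g : EuclideanSpace ℝ (Fin n) → ℝ) : ℝ :=
  ∫ x, relEntropyIntegrand f g x

/-- The centred Gaussian density `(2πσ)^(-n/2) exp (-|x|² / (2σ))` on `ℝⁿ`. -/
def gaussianDensity {n : ℕ} (σ : ℝ) (x : EuclideanSpace ℝ (Fin n)) : ℝ :=
  (1 / (2 * Real.pi * σ)) ^ ((n : ℝ) / 2) * Real.exp (-‖x‖ ^ 2 / (2 * σ))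

/-- `v t x` is a solution, for `t ≥ 0` and `x ∈ ℝⁿ`, of the initial value problem
`∂v/∂t = Δv`, `v(0) = v₀`: a curve in `C([0,∞); L¹(ℝⁿ))` starting at `v₀` that solves the heat
equation classically for `t > 0`. The values of `v` at negative times play no role. -/
structure IsHeatSolution {n : ℕ} (v : ℝ → EuclideanSpace ℝ (Fin n) → ℝ)
    (v₀ : EuclideanSpace ℝ (Fin n) → ℝ) : Prop where
  contDiff_space : ∀ t, 0 < t → ContDiff ℝ 2 (v t)
  continuousOn_laplacian :
    ContinuousOn (fun p : ℝ × EuclideanSpace ℝ (Fin n) => Laplacian.laplacian (v p.1) p.2)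
      (Ioi 0 ×ˢ univ)
  heat_eq : ∀ t, 0 < t → ∀ x,
    HasDerivAt (fun s => v s x) (Laplacian.laplacian (v t) x) t
  integrable : ∀ t, 0 ≤ t → Integrable (v t)
  continuous_L1 : ∀ t, 0 ≤ t →
    Tendsto (fun s => ∫ x, |v s x - v t x|) (𝓝[Ici 0] t) (𝓝 0)
  initial : v 0 =ᵐ[volume] v₀

end

/-! The heart is a linear entropy contraction for a well-chosen Gaussian reference. For every `σ >
0`, adding Gaussian noise of variance `τ` multiplies the entropy relative to `M_σ` by at most `σ /
(σ + τ)`, the new reference being `M_{σ+τ}` (`relEntropy_conv_gaussianLaw_le`). Changing the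
variance of the reference costs only terms in the mass and second moment
(`relEntropy_gaussianDensity_change`). With `s = E₀ / n` and `H = H(v₀|M_s)`, take `σ = s
exp(-2H/n)`, the variance of the Gaussian with the Shannon entropy of `v₀`; this choice minimises
the resulting bound. Passing from `M_s` to `M_σ`, contracting with `τ = 2t` and passing on to
`M_{s+2t}` makes the moment terms cancel and leaves `(n/2) log((s + 2t) / (σ + 2t))`, which is the
claim.

The contraction is a strong data processing inequality for correlated Gaussians. It starts from two
correlated signs, where the constant `ρ²` is read off a power series (`two_point_sdpi`). In the dual
form `SDPI` the inequality survives convolution (`SDPI.conv`) and weak limits (`SDPI.of_tendsto`),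
so the central limit theorem carries it to Gaussian pairs (`sdpi_stdGaussian`). An exponential test
function turns it into an exponential-moment bound (`gaussian_exp_average_le`). The Gibbs
variational principle and truncated logarithms then bring it back to entropy.

An abstract heat solution is identified with Gaussian convolution by computing its Fourier modes
with cut-off plane waves (`IsHeatSolution.integral_mul_cos`); nonnegativity comes out of the same
identity (`IsHeatSolution.nonneg_and_withDensity_eq`). Convergence to zero follows by squeezing
between `relEntropy_nonneg` and the bound. -/

open ProbabilityTheory
open scoped BoundedContinuousFunction

/-! ### Two-point inequality for correlated signs -/

/-- The binary relative entropy function `(1 + x) log (1 + x) + (1 - x) log (1 - x)`. -/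
noncomputable def binRelEntropy (x : ℝ) : ℝ :=
  (1 + x) * Real.log (1 + x) + (1 - x) * Real.log (1 - x)

theorem continuous_binRelEntropy : Continuous binRelEntropy := by
  unfold binRelEntropy
  exact (Real.continuous_mul_log.comp (by fun_prop : Continuous fun x : ℝ => 1 + x)).add
    (Real.continuous_mul_log.comp (by fun_prop : Continuous fun x : ℝ => 1 - x))

/-- Regrouping as `x (log (1 + x) - log (1 - x)) + log (1 - x²)` combines two known series. What
matters later is that all coefficients are nonnegative and the expansion starts at `x²`. -/
theorem hasSum_binRelEntropy {x : ℝ} (hx : |x| < 1) :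
    HasSum (fun k : ℕ => (1 / ((2 * k + 1) * (k + 1)) : ℝ) * (x ^ 2) ^ (k + 1))
      (binRelEntropy x) := by
  have h1 := (Real.hasSum_log_sub_log_of_abs_lt_one hx).mul_left x
  have hx2 : |x ^ 2| < 1 := by
    rw [abs_pow]
    exact pow_lt_one₀ (abs_nonneg x) hx two_ne_zero
  have h2 := (Real.hasSum_pow_div_log_of_abs_lt_one hx2).neg
  obtain ⟨ha, hb⟩ := abs_lt.mp hx
  have hf : (fun k : ℕ => (1 / ((2 * k + 1) * (k + 1)) : ℝ) * (x ^ 2) ^ (k + 1)) =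
      fun k : ℕ => x * (2 * (1 / (2 * (k : ℝ) + 1)) * x ^ (2 * k + 1))
        + -((x ^ 2) ^ (k + 1) / ((k : ℝ) + 1)) := by
    ext k
    have : (2 * (k : ℝ) + 1) ≠ 0 := by positivity
    have : (k : ℝ) + 1 ≠ 0 := by positivity
    field_simp
    ring
  have hl : binRelEntropy x =
      x * (Real.log (1 + x) - Real.log (1 - x)) + - -Real.log (1 - x ^ 2) := by
    have : Real.log (1 - x ^ 2) = Real.log (1 + x) + Real.log (1 - x) := by
      rw [← Real.log_mul (by linarith) (by linarith)]
      ring_nf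
    rw [this, binRelEntropy]
    ring
  rw [hf, hl]
  exact h1.add h2

/-- Termwise, `ρ^(2(k+1)) ≤ ρ²`. The endpoints `|x| = 1`, which occur when one of two masses
vanishes, are reached by continuity. -/
theorem binRelEntropy_mul_le {ρ x : ℝ} (hρ0 : 0 ≤ ρ) (hρ1 : ρ ≤ 1) (hx : |x| ≤ 1) :
    binRelEntropy (ρ * x) ≤ ρ ^ 2 * binRelEntropy x := by
  have key : ∀ y ∈ Ioo (-1 : ℝ) 1, binRelEntropy (ρ * y) ≤ ρ ^ 2 * binRelEntropy y := by
    intro y hy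
    have hy' : |y| < 1 := abs_lt.mpr hy
    have hρy : |ρ * y| < 1 := by
      rw [abs_mul, abs_of_nonneg hρ0]
      nlinarith [abs_nonneg y]
    refine hasSum_le (fun k => ?_) (hasSum_binRelEntropy hρy)
      ((hasSum_binRelEntropy hy').mul_left (ρ ^ 2))
    have h1 : (ρ ^ 2) ^ (k + 1) ≤ ρ ^ 2 := by
      rw [pow_succ]
      exact mul_le_of_le_one_left (by positivity) (pow_le_one₀ (by positivity)
        (pow_le_one₀ hρ0 hρ1))
    rw [mul_pow, mul_pow]
    have h2 : 0 ≤ (1 / ((2 * k + 1) * (k + 1)) : ℝ) * (y ^ 2) ^ (k + 1) := by positivity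
    nlinarith [mul_le_mul_of_nonneg_right h1 h2]
  have hcl : IsClosed {y : ℝ | binRelEntropy (ρ * y) ≤ ρ ^ 2 * binRelEntropy y} :=
    isClosed_le (continuous_binRelEntropy.comp (by fun_prop))
      (continuous_const.mul continuous_binRelEntropy)
  have := hcl.closure_subset_iff.mpr key
  rw [closure_Ioo (by norm_num)] at this
  exact this (abs_le.mp hx)

theorem sub_le_mul_log_div {a b : ℝ} (ha : 0 ≤ a) (hb : 0 < b) :
    a - b ≤ a * Real.log (a / b) := by
  rcases ha.eq_or_lt with rfl | ha
  · simp [hb.le]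
  · have h := Real.one_sub_inv_le_log_of_pos (div_pos ha hb)
    have := mul_le_mul_of_nonneg_left h ha.le
    rw [inv_div] at this
    calc a - b = a * (1 - b / a) := by field_simp
      _ ≤ _ := this

/-- Pointwise Gibbs inequality: this is `sub_le_mul_log_div` against the tilted weight `m exp g /
Z`. When `Z` is the average of `exp g`, these weights average to `m` and the linear terms disappear.
-/
theorem mul_le_mul_log_add {h m g Z : ℝ} (hh : 0 ≤ h) (hm : 0 < m) (hZ : 0 < Z) :
    h * g ≤ h * Real.log h - h + m * Real.exp g / Z - h * Real.log m + h * Real.log Z := by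
  have h1 := sub_le_mul_log_div hh (show 0 < m * Real.exp g / Z by positivity)
  rcases hh.eq_or_lt with rfl | hh
  · simp at h1 ⊢
    positivity
  · rw [Real.log_div hh.ne' (by positivity), Real.log_div (by positivity) hZ.ne',
      Real.log_mul hm.ne' (Real.exp_pos _).ne', Real.log_exp] at h1
    linarith

theorem half_mul_log_add_eq {m x : ℝ} (hm : 0 < m) :
    (m * (1 + x)) * Real.log (m * (1 + x)) + (m * (1 - x)) * Real.log (m * (1 - x)) =
      2 * (m * Real.log m) + m * binRelEntropy x := by
  have aux : ∀ y : ℝ, (m * y) * Real.log (m * y) = m * y * Real.log m + m * (y * Real.log y) := by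
    intro y
    rcases eq_or_ne y 0 with rfl | hy
    · simp
    · rw [Real.log_mul hm.ne' hy]
      ring
  rw [aux, aux, binRelEntropy]
  ring

/-- Writing `f₁, f₂ = m (1 ± x)`, averaging given the other sign yields `m (1 ± ρ x)`. Gibbs against
`g` bounds the left side by the entropy of these averages, and `binRelEntropy_mul_le` gains the
factor `ρ²`. -/
theorem two_point_sdpi {ρ : ℝ} (hρ0 : 0 ≤ ρ) (hρ1 : ρ ≤ 1) {f₁ f₂ : ℝ} (h₁ : 0 ≤ f₁) (h₂ : 0 ≤ f₂)
    (g₁ g₂ : ℝ) :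
    (1 + ρ) / 4 * (f₁ * g₁) + (1 + ρ) / 4 * (f₂ * g₂) + (1 - ρ) / 4 * (f₁ * g₂)
        + (1 - ρ) / 4 * (f₂ * g₁) ≤
      ρ ^ 2 * ((f₁ * Real.log f₁ + f₂ * Real.log f₂) / 2
          - (f₁ + f₂) / 2 * Real.log ((f₁ + f₂) / 2)) +
        (f₁ + f₂) / 2 * Real.log ((Real.exp g₁ + Real.exp g₂) / 2) := by
  obtain ⟨m, hm⟩ : ∃ m, m = (f₁ + f₂) / 2 := ⟨_, rfl⟩
  rw [← hm]
  have hm0 : 0 ≤ m := by rw [hm]; positivity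
  rcases hm0.eq_or_lt with h0 | hmpos
  · have e1 : f₁ = 0 := by linarith
    have e2 : f₂ = 0 := by linarith
    simp [e1, e2, ← h0]
  obtain ⟨x, hx⟩ : ∃ x, x = f₁ / m - 1 := ⟨_, rfl⟩
  have e1 : f₁ = m * (1 + x) := by rw [hx]; field_simp; ring
  have e2 : f₂ = m * (1 - x) := by linarith
  have hx1 : |x| ≤ 1 := by
    rw [abs_le]
    constructor <;> nlinarith
  have hxa := abs_le.mp hx1
  have k1 : 0 ≤ m * (1 + ρ * x) := mul_nonneg hm0 (by nlinarith)
  have k2 : 0 ≤ m * (1 - ρ * x) := mul_nonneg hm0 (by nlinarith)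
  obtain ⟨Z, hZ⟩ : ∃ Z, Z = (Real.exp g₁ + Real.exp g₂) / 2 := ⟨_, rfl⟩
  have hZ0 : 0 < Z := by rw [hZ]; positivity
  have i1 := mul_le_mul_log_add (g := g₁) k1 hmpos hZ0
  have i2 := mul_le_mul_log_add (g := g₂) k2 hmpos hZ0
  have e3 := half_mul_log_add_eq (x := x) hmpos
  have e4 := half_mul_log_add_eq (x := ρ * x) hmpos
  have e5 := mul_le_mul_of_nonneg_left (binRelEntropy_mul_le hρ0 hρ1 hx1) hm0
  have e6 : m * Real.exp g₁ / Z + m * Real.exp g₂ / Z = 2 * m := by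
    rw [← add_div, ← mul_add, show Real.exp g₁ + Real.exp g₂ = 2 * Z by rw [hZ]; ring]
    field_simp
  rw [← hZ, e1, e2]
  linear_combination (i1 + i2) / 2 + e4 / 2 + e6 / 2 + e5 / 2 + ρ ^ 2 / 2 * (-e3)

/-! ### Dual strong data processing inequality: convolution and weak limits -/

/-- The strong data processing inequality with constant `c` for the pair `(A, B)` under `μ`, in
dual form: the test functions are a nonnegative function of `A` and a function of `B`. -/
def SDPI {V E : Type*} [MeasurableSpace V] [TopologicalSpace E]
    (c : ℝ) (A B : V → E) (μ : Measure V) : Prop :=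
  ∀ f g : E →ᵇ ℝ, (∀ x, 0 ≤ f x) →
    ∫ x, f (A x) * g (B x) ∂μ ≤
      c * (∫ x, f (A x) * Real.log (f (A x)) ∂μ
          - (∫ x, f (A x) ∂μ) * Real.log (∫ x, f (A x) ∂μ)) +
        (∫ x, f (A x) ∂μ) * Real.log (∫ x, Real.exp (g (B x)) ∂μ)

/-- Composition of a bounded continuous function with a continuous one. -/
noncomputable def BoundedContinuousFunction.postcomp {E : Type*} [TopologicalSpace E]
    (φ : ℝ → ℝ) (hφ : Continuous φ) (f : E →ᵇ ℝ) : E →ᵇ ℝ :=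
  BoundedContinuousFunction.mkOfBound ⟨fun x => φ (f x), hφ.comp f.continuous⟩
    (Classical.choose (Metric.isBounded_iff.mp
      ((isCompact_closedBall (0 : ℝ) ‖f‖).image hφ).isBounded))
    (fun x y => by
      refine Classical.choose_spec (Metric.isBounded_iff.mp
        ((isCompact_closedBall (0 : ℝ) ‖f‖).image hφ).isBounded) ?_ ?_
      · exact ⟨f x, by simpa using f.norm_coe_le_norm x, rfl⟩
      · exact ⟨f y, by simpa using f.norm_coe_le_norm y, rfl⟩)

@[simp] theorem BoundedContinuousFunction.postcomp_apply {E : Type*} [TopologicalSpace E]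
    (φ : ℝ → ℝ) (hφ : Continuous φ) (f : E →ᵇ ℝ) (x : E) : f.postcomp φ hφ x = φ (f x) := rfl

theorem BoundedContinuousFunction.integrable_comp {V E : Type*} [MeasurableSpace V]
    [TopologicalSpace E] [TopologicalSpace V] [OpensMeasurableSpace V]
    (μ : Measure V) [IsFiniteMeasure μ] (f : E →ᵇ ℝ) {A : V → E} (hA : Continuous A) :
    Integrable (fun x => f (A x)) μ :=
  (f.compContinuous ⟨A, hA⟩).integrable μ

/-- Average of the translates of a bounded continuous function. -/
noncomputable def BoundedContinuousFunction.average {V E : Type*} [MeasurableSpace V]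
    [TopologicalSpace V] [OpensMeasurableSpace V] [NormedAddCommGroup E]
    (μ : Measure V) [IsProbabilityMeasure μ] (A : V → E) (hA : Continuous A) (f : E →ᵇ ℝ) :
    E →ᵇ ℝ :=
  BoundedContinuousFunction.ofNormedAddCommGroup (fun a => ∫ y, f (a + A y) ∂μ)
    (by
      refine continuous_of_dominated (bound := fun _ => ‖f‖) (fun a => ?_) (fun a => ?_) ?_ ?_
      · exact (f.integrable_comp μ (by fun_prop)).aestronglyMeasurable
      · exact Eventually.of_forall fun y => f.norm_coe_le_norm _
      · exact integrable_const _
      · exact Eventually.of_forall fun y => by fun_prop)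
    ‖f‖
    (fun a => by
      refine (norm_integral_le_of_norm_le_const
        (Eventually.of_forall fun y => f.norm_coe_le_norm _)).trans ?_
      simp)

@[simp] theorem BoundedContinuousFunction.average_apply {V E : Type*} [MeasurableSpace V]
    [TopologicalSpace V] [OpensMeasurableSpace V] [NormedAddCommGroup E]
    (μ : Measure V) [IsProbabilityMeasure μ] (A : V → E) (hA : Continuous A) (f : E →ᵇ ℝ) (a : E) :
    f.average μ A hA a = ∫ y, f (a + A y) ∂μ := rfl

theorem integral_exp_bounds {V E : Type*} [MeasurableSpace V] [TopologicalSpace V]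
    [OpensMeasurableSpace V] [TopologicalSpace E] {μ : Measure V} [IsProbabilityMeasure μ] (g : E →ᵇ ℝ) {B : V → E}
    (hB : Continuous B) :
    Real.exp (-‖g‖) ≤ ∫ x, Real.exp (g (B x)) ∂μ ∧ ∫ x, Real.exp (g (B x)) ∂μ ≤ Real.exp ‖g‖ := by
  have hi := (g.postcomp _ Real.continuous_exp).integrable_comp μ hB
  have h1 := integral_mono (μ := μ) (integrable_const (Real.exp (-‖g‖))) hi fun x => by
    have := abs_le.mp (g.norm_coe_le_norm (B x))
    simpa using this.1
  have h2 := integral_mono (μ := μ) hi (integrable_const (Real.exp (‖g‖))) fun x => by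
    have := abs_le.mp (g.norm_coe_le_norm (B x))
    simpa using this.2
  simp at h1 h2
  exact ⟨h1, h2⟩

section
variable {V E : Type*} [NormedAddCommGroup V] [NormedSpace ℝ V] [MeasurableSpace V] [BorelSpace V]
  [NormedAddCommGroup E] [NormedSpace ℝ E]

theorem SDPI.map_smul {c : ℝ} {A B : V →L[ℝ] E} {μ : Measure V} (h : SDPI c A B μ) (r : ℝ) :
    SDPI c A B (μ.map (r • ·)) := by
  intro f g hf
  have hm : AEMeasurable (fun x : V => r • x) μ := by fun_prop
  have key : ∀ F : V → ℝ, Continuous F →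
      ∫ x, F x ∂(μ.map (r • ·)) = ∫ x, F (r • x) ∂μ := fun F hF =>
    integral_map hm hF.aestronglyMeasurable
  have h1 : Continuous fun x : V => f (A x) * Real.log (f (A x)) :=
    Real.continuous_mul_log.comp (by fun_prop)
  rw [key _ (by fun_prop), key _ h1, key _ (by fun_prop), key _ (by fun_prop)]
  have := h (f.compContinuous ⟨fun x => r • x, by fun_prop⟩)
    (g.compContinuous ⟨fun x => r • x, by fun_prop⟩) (fun x => hf _)
  simpa using this

/-- Logarithm of the exponential average of the translates of a bounded continuous function. -/
noncomputable def BoundedContinuousFunction.logExpAverage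
    (μ : Measure V) [IsProbabilityMeasure μ] (A : V → E) (hA : Continuous A) (g : E →ᵇ ℝ) :
    E →ᵇ ℝ :=
  BoundedContinuousFunction.ofNormedAddCommGroup
    (fun a => Real.log (∫ y, Real.exp (g (a + A y)) ∂μ))
    (by
      refine Continuous.log ((g.postcomp _ Real.continuous_exp).average μ A hA).continuous ?_
      intro a
      have := (integral_exp_bounds (μ := μ) g (B := fun y => a + A y) (by fun_prop)).1
      exact (lt_of_lt_of_le (Real.exp_pos _) this).ne')
    ‖g‖
    (fun a => by
      obtain ⟨h1, h2⟩ := integral_exp_bounds (μ := μ) g (B := fun y => a + A y) (by fun_prop)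
      have h0 := lt_of_lt_of_le (Real.exp_pos _) h1
      rw [Real.norm_eq_abs, abs_le]
      exact ⟨(Real.le_log_iff_exp_le h0).mpr h1, (Real.log_le_iff_le_exp h0).mpr h2⟩)

@[simp] theorem BoundedContinuousFunction.logExpAverage_apply
    (μ : Measure V) [IsProbabilityMeasure μ] (A : V → E) (hA : Continuous A) (g : E →ᵇ ℝ) (a : E) :
    g.logExpAverage μ A hA a = Real.log (∫ y, Real.exp (g (a + A y)) ∂μ) := rfl

/-- This is tensorisation by the chain rule for entropy. With the first summand frozen, the
hypothesis on `ν` applies to the translated test functions. The hypothesis on `μ` is then applied to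
the average of `f` and the log-exponential average of `g`, and the intermediate entropies telescope
with the same constant `c`. -/
theorem SDPI.conv [SecondCountableTopology V] {c : ℝ} {A B : V →L[ℝ] E} {μ ν : Measure V} [IsProbabilityMeasure μ]
    [IsProbabilityMeasure ν] (hμ : SDPI c A B μ) (hν : SDPI c A B ν) :
    SDPI c A B (μ ∗ ν) := by
  intro f g hf
  set fl := f.postcomp _ Real.continuous_mul_log with hfl
  set ge := g.postcomp _ Real.continuous_exp with hge
  set f' := f.average ν A A.continuous with hf'
  set g' := g.logExpAverage ν B B.continuous with hg'
  have hf0 : ∀ x, 0 ≤ f' x := fun x => integral_nonneg fun y => hf _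
  have key : ∀ (F : E →ᵇ ℝ) (L : V →L[ℝ] E),
      ∫ x, F (L x) ∂(μ ∗ ν) = ∫ x, (F.average ν L L.continuous) (L x) ∂μ := by
    intro F L
    rw [integral_conv (F.integrable_comp _ L.continuous)]
    simp
  have hfg : ∫ x, f (A x) * g (B x) ∂(μ ∗ ν) =
      ∫ x, ∫ y, f (A x + A y) * g (B x + B y) ∂ν ∂μ := by
    rw [integral_conv]
    · simp
    · exact (f.compContinuous ⟨A, A.continuous⟩ * g.compContinuous ⟨B, B.continuous⟩).integrable _
  have e1 : ∫ x, f (A x) * Real.log (f (A x)) ∂(μ ∗ ν) =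
      ∫ x, (fl.average ν A A.continuous) (A x) ∂μ := key fl A
  have e2 : ∫ x, Real.exp (g (B x)) ∂(μ ∗ ν) = ∫ x, Real.exp (g' (B x)) ∂μ := by
    rw [show (fun x => Real.exp (g (B x))) = fun x => ge (B x) from rfl, key ge B]
    congr 1
    ext x
    rw [hg', BoundedContinuousFunction.logExpAverage_apply, Real.exp_log]
    · rfl
    · have := (integral_exp_bounds (μ := ν) g (B := fun y => B x + B y) (by fun_prop)).1
      exact lt_of_lt_of_le (Real.exp_pos _) this
  -- The inequality conditional on the first summand `x`; it is integrated over `μ` below.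
  have hpt : ∀ x, ∫ y, f (A x + A y) * g (B x + B y) ∂ν ≤
      c * ((fl.average ν A A.continuous) (A x) - f' (A x) * Real.log (f' (A x)))
        + f' (A x) * g' (B x) := fun x =>
    hν (f.compContinuous ⟨fun y => A x + y, by fun_prop⟩)
      (g.compContinuous ⟨fun y => B x + y, by fun_prop⟩) (fun y => hf _)
  have i1 := (fl.average ν A A.continuous).integrable_comp μ A.continuous
  have i2 : Integrable (fun x => f' (A x) * Real.log (f' (A x))) μ :=
    (f'.postcomp _ Real.continuous_mul_log).integrable_comp μ A.continuous
  have i3 : Integrable (fun x => f' (A x) * g' (B x)) μ :=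
    (f'.compContinuous ⟨A, A.continuous⟩ * g'.compContinuous ⟨B, B.continuous⟩).integrable _
  have i4 : Integrable (fun x => ∫ y, f (A x + A y) * g (B x + B y) ∂ν) μ := by
    have : Integrable (fun x => f (A x) * g (B x)) (μ ∗ ν) :=
      (f.compContinuous ⟨A, A.continuous⟩ * g.compContinuous ⟨B, B.continuous⟩).integrable _
    have h2 := (integrable_map_measure this.aestronglyMeasurable (by fun_prop)).mp this
    simpa [Function.comp_def] using h2.integral_prod_left
  have hint := integral_mono i4 (((i1.sub i2).const_mul c).add i3) hpt
  have hμ' := hμ f' g' hf0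
  rw [hfg, e1, e2, show ∫ x, f (A x) ∂(μ ∗ ν) = ∫ x, f' (A x) ∂μ from key f A]
  have e3 : ∫ x, (c * ((fl.average ν A A.continuous) (A x) - f' (A x) * Real.log (f' (A x)))
      + f' (A x) * g' (B x)) ∂μ =
      ∫ x, c * ((fl.average ν A A.continuous) (A x) - f' (A x) * Real.log (f' (A x))) ∂μ
        + ∫ x, f' (A x) * g' (B x) ∂μ := integral_add ((i1.sub i2).const_mul c) i3
  rw [integral_const_mul, integral_sub i1 i2] at e3
  have h5 := hint.trans_eq e3
  linarith

/-- In the dual form every integrand is bounded and continuous, so each term passes to the weak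
limit; a density formulation would offer only semicontinuity. -/
theorem SDPI.of_tendsto {c : ℝ} {A B : V →L[ℝ] E} {μ : ℕ → ProbabilityMeasure V}
    {ν : ProbabilityMeasure V} (h : ∀ k, SDPI c A B (μ k : Measure V))
    (hlim : Tendsto μ atTop (𝓝 ν)) : SDPI c A B (ν : Measure V) := by
  intro f g hf
  rw [ProbabilityMeasure.tendsto_iff_forall_integral_tendsto] at hlim
  set fA := f.compContinuous ⟨A, A.continuous⟩
  set gB := g.compContinuous ⟨B, B.continuous⟩
  have t1 := hlim (fA * gB)
  have t2 := hlim (fA.postcomp _ Real.continuous_mul_log)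
  have t3 := hlim fA
  have t4 := hlim (gB.postcomp _ Real.continuous_exp)
  have hpos : ∫ x, Real.exp (g (B x)) ∂(ν : Measure V) ≠ 0 := by
    have := (integral_exp_bounds (μ := (ν : Measure V)) g B.continuous).1
    exact (lt_of_lt_of_le (Real.exp_pos _) this).ne'
  have t5 := (Real.continuous_mul_log.tendsto _).comp t3
  refine le_of_tendsto_of_tendsto' t1
    (((t2.sub t5).const_mul c).add (t3.mul (t4.log hpos))) fun k => ?_
  exact h k f g hf

end

/-! ### Correlated signs in two directions -/

section
variable {V : Type*} [NormedAddCommGroup V] [MeasurableSpace V]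

/-- The law of `ε u + ε' w` for signs `ε, ε'` with correlation `ρ`. -/
noncomputable def correlatedSigns (ρ : ℝ) (u w : V) : Measure V :=
  ENNReal.ofReal ((1 + ρ) / 4) • Measure.dirac (u + w) +
    ENNReal.ofReal ((1 + ρ) / 4) • Measure.dirac (-u - w) +
    ENNReal.ofReal ((1 - ρ) / 4) • Measure.dirac (u - w) +
    ENNReal.ofReal ((1 - ρ) / 4) • Measure.dirac (w - u)

theorem integrable_correlatedSigns [BorelSpace V] {G : Type*} [NormedAddCommGroup G]
    {ρ : ℝ} {u w : V} (F : V → G) : Integrable F (correlatedSigns ρ u w) := by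
  unfold correlatedSigns
  have h : ∀ (r : ℝ) (a : V), Integrable F (ENNReal.ofReal r • Measure.dirac a) := fun r a =>
    (integrable_dirac (by simp)).smul_measure ENNReal.ofReal_ne_top
  exact (((h _ _).add_measure (h _ _)).add_measure (h _ _)).add_measure (h _ _)

theorem integral_correlatedSigns [BorelSpace V] {G : Type*} [NormedAddCommGroup G] [NormedSpace ℝ G]
    [CompleteSpace G] {ρ : ℝ} (h0 : 0 ≤ ρ) (h1 : ρ ≤ 1) (u w : V) (F : V → G) :
    ∫ x, F x ∂(correlatedSigns ρ u w) = ((1 + ρ) / 4) • F (u + w) + ((1 + ρ) / 4) • F (-u - w)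
      + ((1 - ρ) / 4) • F (u - w) + ((1 - ρ) / 4) • F (w - u) := by
  unfold correlatedSigns
  have h : ∀ (r : ℝ) (a : V), Integrable F (ENNReal.ofReal r • Measure.dirac a) := fun r a =>
    (integrable_dirac (by simp)).smul_measure ENNReal.ofReal_ne_top
  rw [integral_add_measure (((h _ _).add_measure (h _ _)).add_measure (h _ _)) (h _ _),
    integral_add_measure ((h _ _).add_measure (h _ _)) (h _ _),
    integral_add_measure (h _ _) (h _ _)]
  simp only [integral_smul_measure, integral_dirac]
  rw [ENNReal.toReal_ofReal (by linarith), ENNReal.toReal_ofReal (by linarith)]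

theorem isProbabilityMeasure_correlatedSigns {ρ : ℝ} (h0 : 0 ≤ ρ) (h1 : ρ ≤ 1) (u w : V) :
    IsProbabilityMeasure (correlatedSigns ρ u w) := by
  constructor
  simp only [correlatedSigns, Measure.add_apply, Measure.smul_apply, measure_univ, smul_eq_mul,
    mul_one]
  rw [← ENNReal.ofReal_add (by linarith) (by linarith),
    ← ENNReal.ofReal_add (by linarith) (by linarith),
    ← ENNReal.ofReal_add (by linarith) (by linarith), ← ENNReal.ofReal_one]
  congr 1
  ring

/-- Since `A w = 0` and `B u = 0`, `A` sees only the sign of `u` and `B` only that of `w`, which is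
the two-point situation. -/
theorem sdpi_correlatedSigns [BorelSpace V] [NormedSpace ℝ V] {E : Type*} [NormedAddCommGroup E] [NormedSpace ℝ E]
    {ρ : ℝ} (h0 : 0 ≤ ρ) (h1 : ρ ≤ 1) (u w : V) (A B : V →L[ℝ] E) (hA : A w = 0) (hB : B u = 0) :
    SDPI (ρ ^ 2) A B (correlatedSigns ρ u w) := by
  intro f g hf
  simp only [integral_correlatedSigns h0 h1, map_add, map_sub, map_neg, hA, hB, smul_eq_mul,
    add_zero, zero_add, sub_zero, zero_sub, neg_zero]
  have := two_point_sdpi h0 h1 (hf (A u)) (hf (-A u)) (g (B w)) (g (-B w))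
  have e1 : ∀ a b : ℝ, (1 + ρ) / 4 * a + (1 + ρ) / 4 * b + (1 - ρ) / 4 * a + (1 - ρ) / 4 * b =
      (a + b) / 2 := fun a b => by ring
  have e2 : ∀ a b : ℝ, (1 + ρ) / 4 * a + (1 + ρ) / 4 * b + (1 - ρ) / 4 * b + (1 - ρ) / 4 * a =
      (a + b) / 2 := fun a b => by ring
  rw [e1, e1, e2]
  exact this

end

/-! ### Central limit theorem for the inequality -/

section
variable {V : Type*} [NormedAddCommGroup V] [InnerProductSpace ℝ V] [MeasurableSpace V]
  [BorelSpace V] [SecondCountableTopology V]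

/-- Projecting to the line spanned by `ξ` and normalising by `√q` reduces this to the
one-dimensional central limit theorem. When `q = 0` the projection vanishes almost surely and cannot
be normalised. -/
theorem tendsto_charFun_inv_sqrt_smul_pow {ν : Measure V} [IsProbabilityMeasure ν] {ξ : V} {q : ℝ}
    (hmean : ∫ x, inner ℝ x ξ ∂ν = 0) (hvar : ∫ x, (inner ℝ x ξ) ^ 2 ∂ν = q)
    (hint : Integrable (fun x => (inner ℝ x ξ) ^ 2) ν) :
    Tendsto (fun N : ℕ => charFun ν ((√(N : ℝ))⁻¹ • ξ) ^ N) atTop (𝓝 (Complex.exp (-q / 2))) := by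
  have hq : 0 ≤ q := hvar ▸ integral_nonneg fun x => sq_nonneg _
  rcases hq.eq_or_lt with rfl | hq
  · have h0 : ∀ᵐ x ∂ν, inner ℝ x ξ = 0 := by
      filter_upwards [(integral_eq_zero_iff_of_nonneg (fun x => sq_nonneg _) hint).mp hvar]
        with x hx
      simpa using hx
    have h1 : ∀ r : ℝ, charFun ν (r • ξ) = 1 := by
      intro r
      rw [charFun_apply]
      rw [integral_congr_ae (g := fun _ => (1 : ℂ))]
      · simp
      · filter_upwards [h0] with x hx
        simp [inner_smul_right, hx]
    simp [h1]
  · have hs : 0 < √q := Real.sqrt_pos.mpr hq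
    have hX : AEMeasurable (fun x : V => (√q)⁻¹ * inner ℝ x ξ) ν := by fun_prop
    have hm0 : ∫ x, (fun x : V => (√q)⁻¹ * inner ℝ x ξ) x ∂ν = 0 := by
      simp only [integral_const_mul, hmean, mul_zero]
    have hm1 : ∫ x, ((fun x : V => (√q)⁻¹ * inner ℝ x ξ) ^ 2) x ∂ν = 1 := by
      simp only [Pi.pow_apply, mul_pow, integral_const_mul, hvar, inv_pow, Real.sq_sqrt hq.le]
      field_simp
    have h := tendsto_charFun_inv_sqrt_mul_pow hX hm0 hm1 (√q)
    have e : ∀ s : ℝ, charFun (ν.map fun x : V => (√q)⁻¹ * inner ℝ x ξ) s =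
        charFun ν ((s * (√q)⁻¹) • ξ) := by
      intro s
      rw [charFun_apply_real, charFun_apply, integral_map hX (by fun_prop)]
      congr 1
      ext x
      rw [inner_smul_right]
      push_cast
      ring_nf
    simp only [e, mul_assoc, mul_inv_cancel₀ hs.ne', mul_one] at h
    convert h using 3
    rw [← Complex.ofReal_pow, Real.sq_sqrt hq.le]

theorem SDPI.dirac_zero {E : Type*} [NormedAddCommGroup E] [NormedSpace ℝ E] (c : ℝ)
    (A B : V →L[ℝ] E) : SDPI c A B (Measure.dirac 0) := by
  intro f g hf
  simp

theorem SDPI.exists_prod {E : Type*} [NormedAddCommGroup E] [NormedSpace ℝ E] {c : ℝ}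
    {A B : V →L[ℝ] E} {ι : Type*} (s : Finset ι) (ν : ι → Measure V)
    (hν : ∀ i, IsProbabilityMeasure (ν i)) (h : ∀ i, SDPI c A B (ν i)) :
    ∃ μ : Measure V, IsProbabilityMeasure μ ∧ SDPI c A B μ ∧
      ∀ ξ, charFun μ ξ = ∏ i ∈ s, charFun (ν i) ξ := by
  classical
  induction s using Finset.induction_on with
  | empty => exact ⟨Measure.dirac 0, inferInstance, SDPI.dirac_zero c A B, fun ξ => by simp⟩
  | insert a s ha ih =>
    obtain ⟨μ, h1, h2, h3⟩ := ih
    have := hν a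
    exact ⟨ν a ∗ μ, inferInstance, (h a).conv h2, fun ξ => by
      rw [charFun_conv, h3, Finset.prod_insert ha]⟩

/-- Central limit theorem for the strong data processing inequality. -/
theorem SDPI.of_clt [CompleteSpace V] [FiniteDimensional ℝ V]
    {E : Type*} [NormedAddCommGroup E] [NormedSpace ℝ E] {c : ℝ}
    {A B : V →L[ℝ] E} {ι : Type*} [Fintype ι] (ν : ι → Measure V)
    (hν : ∀ i, IsProbabilityMeasure (ν i)) (h : ∀ i, SDPI c A B (ν i)) (q : ι → V → ℝ)
    (hmean : ∀ i ξ, ∫ x, inner ℝ x ξ ∂(ν i) = 0)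
    (hvar : ∀ i ξ, ∫ x, (inner ℝ x ξ) ^ 2 ∂(ν i) = q i ξ)
    (hint : ∀ i ξ, Integrable (fun x => (inner ℝ x ξ) ^ 2) (ν i))
    (γ : Measure V) [IsProbabilityMeasure γ]
    (hγ : ∀ ξ, charFun γ ξ = Complex.exp (-(∑ i, q i ξ : ℝ) / 2)) : SDPI c A B γ := by
  obtain ⟨μ, hμ, hμS, hμc⟩ := SDPI.exists_prod Finset.univ ν hν h
  -- `μ` collects one step in every direction; `P N` is the law of a sum of `N` independent copies
  -- of it.
  choose P hP hPS hPc using fun N : ℕ =>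
    SDPI.exists_prod (Finset.range N) (fun _ => μ) (fun _ => hμ) (fun _ => hμS)
  have hm : ∀ N : ℕ, IsProbabilityMeasure ((P N).map ((√(N : ℝ))⁻¹ • ·)) := fun N =>
    Measure.isProbabilityMeasure_map (by fun_prop)
  let Q : ℕ → ProbabilityMeasure V := fun N => ⟨_, hm N⟩
  let Γ : ProbabilityMeasure V := ⟨γ, inferInstance⟩
  refine SDPI.of_tendsto (μ := Q) (ν := Γ) (fun N => (hPS N).map_smul _)
    (ProbabilityMeasure.tendsto_of_tendsto_charFun fun ξ => ?_)
  have e : ∀ N : ℕ, charFun ((P N).map ((√(N : ℝ))⁻¹ • ·)) ξ =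
      ∏ i, charFun (ν i) ((√(N : ℝ))⁻¹ • ξ) ^ N := by
    intro N
    rw [charFun_map_smul, hPc, Finset.prod_const, Finset.card_range, hμc, Finset.prod_pow]
  have e2 : charFun γ ξ = ∏ i, Complex.exp (-(q i ξ : ℂ) / 2) := by
    rw [hγ, ← Complex.exp_sum]
    congr 1
    push_cast
    rw [← Finset.sum_div, Finset.sum_neg_distrib]
  change Tendsto (fun N : ℕ => charFun ((P N).map ((√(N : ℝ))⁻¹ • ·)) ξ) atTop (𝓝 (charFun γ ξ))
  simp only [e, e2]
  exact tendsto_finsetProd _ fun i _ =>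
    tendsto_charFun_inv_sqrt_smul_pow (hmean i ξ) (hvar i ξ) (hint i ξ)

end

/-! ### The Gaussian pair as a limit of correlated signs -/

section
variable {n : ℕ}

/-- The linear map `(x, y) ↦ α x + τ y`. -/
noncomputable def pairCombination (E : Type*) [NormedAddCommGroup E] [NormedSpace ℝ E] (α τ : ℝ) :
    WithLp 2 (E × E) →L[ℝ] E :=
  (α • ContinuousLinearMap.fst ℝ E E + τ • ContinuousLinearMap.snd ℝ E E) ∘L
    (WithLp.prodContinuousLinearEquiv 2 ℝ E E).toContinuousLinearMap

theorem pairCombination_apply {E : Type*} [NormedAddCommGroup E] [NormedSpace ℝ E] (α τ : ℝ)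
    (z : WithLp 2 (E × E)) : pairCombination E α τ z = α • z.fst + τ • z.snd := rfl

/-- The pair `(α X, α X + τ Y)` has coordinate correlation `α / β`. For each coordinate, `u` is
chosen in the kernel of the second map and `w` in that of the first, scaled so that signs with this
correlation have identity covariance on the coordinate plane. -/
theorem sdpi_stdGaussian {α τ β : ℝ} (hα : 0 < α) (hτ : 0 < τ) (hβ : 0 < β)
    (h : β ^ 2 = α ^ 2 + τ ^ 2) :
    SDPI ((α / β) ^ 2) (pairCombination (EuclideanSpace ℝ (Fin n)) α 0)
      (pairCombination (EuclideanSpace ℝ (Fin n)) α τ)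
      (stdGaussian (WithLp 2 (EuclideanSpace ℝ (Fin n) × EuclideanSpace ℝ (Fin n)))) := by
  have hρ0 : 0 ≤ α / β := by positivity
  have hρ1 : α / β ≤ 1 := by
    rw [div_le_one hβ]
    nlinarith [sq_nonneg τ]
  set b := EuclideanSpace.basisFun (Fin n) ℝ
  set u : Fin n → WithLp 2 (EuclideanSpace ℝ (Fin n) × EuclideanSpace ℝ (Fin n)) := fun i =>
    WithLp.toLp 2 (b i, (-(α / τ)) • b i) with hu
  set w : Fin n → WithLp 2 (EuclideanSpace ℝ (Fin n) × EuclideanSpace ℝ (Fin n)) := fun i =>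
    WithLp.toLp 2 (0, (β / τ) • b i) with hw
  refine SDPI.of_clt (fun i => correlatedSigns (α / β) (u i) (w i))
    (fun i => isProbabilityMeasure_correlatedSigns hρ0 hρ1 _ _)
    (fun i => sdpi_correlatedSigns hρ0 hρ1 _ _ _ _ ?_ ?_)
    (fun i ξ => (ξ.fst i) ^ 2 + (ξ.snd i) ^ 2) (fun i ξ => ?_) (fun i ξ => ?_)
    (fun i ξ => integrable_correlatedSigns _) _ (fun ξ => ?_)
  · simp [pairCombination_apply, hw]
  · change α • b i + τ • (-(α / τ)) • b i = 0
    rw [smul_smul, ← add_smul, show α + τ * -(α / τ) = 0 by field_simp; ring, zero_smul]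
  · rw [integral_correlatedSigns hρ0 hρ1]
    simp only [inner_add_left, inner_sub_left, inner_neg_left, smul_eq_mul]
    ring
  · have e1 : inner ℝ (u i) ξ = ξ.fst i - α / τ * ξ.snd i := by
      simp [hu, WithLp.prod_inner_apply, inner_smul_left, b, EuclideanSpace.inner_single_left]
      ring
    have e2 : inner ℝ (w i) ξ = β / τ * ξ.snd i := by
      simp [hw, WithLp.prod_inner_apply, inner_smul_left, b, EuclideanSpace.inner_single_left]
    rw [integral_correlatedSigns hρ0 hρ1]
    simp only [inner_add_left, inner_sub_left, inner_neg_left, smul_eq_mul, e1, e2]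
    field_simp
    -- The mixed term cancels and the coefficient of `(ξ.snd i)²` is `(β² - α²) / τ²`, which equals
    -- `1` by `h`.
    linear_combination 4 * β * (ξ.snd i) ^ 2 * h
  · rw [charFun_stdGaussian]
    congr 2
    rw [Finset.sum_add_distrib, ← EuclideanSpace.real_norm_sq_eq, ← EuclideanSpace.real_norm_sq_eq,
      ← WithLp.prod_norm_sq_eq_of_L2]
    push_cast
    rfl

end

/-! ### Gaussian laws and the exponential-moment inequality -/

section
variable {n : ℕ}

/-- The centred Gaussian law on `ℝⁿ` with covariance `s` times the identity. -/
noncomputable def gaussianLaw (n : ℕ) (s : ℝ) : Measure (EuclideanSpace ℝ (Fin n)) :=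
  (stdGaussian (EuclideanSpace ℝ (Fin n))).map (√s • ·)

instance (s : ℝ) : IsProbabilityMeasure (gaussianLaw n s) :=
  Measure.isProbabilityMeasure_map (by fun_prop)

theorem charFun_gaussianLaw {s : ℝ} (hs : 0 ≤ s) (ξ : EuclideanSpace ℝ (Fin n)) :
    charFun (gaussianLaw n s) ξ = Complex.exp (-(s * ‖ξ‖ ^ 2 : ℝ) / 2) := by
  rw [gaussianLaw, charFun_map_smul, charFun_stdGaussian, norm_smul, Real.norm_eq_abs,
    abs_of_nonneg (Real.sqrt_nonneg s)]
  congr 2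
  rw [← Complex.ofReal_pow, mul_pow, Real.sq_sqrt hs]

theorem gaussianLaw_conv {s t : ℝ} (hs : 0 ≤ s) (ht : 0 ≤ t) :
    gaussianLaw n s ∗ gaussianLaw n t = gaussianLaw n (s + t) := by
  refine Measure.ext_of_charFun (funext fun ξ => ?_)
  rw [charFun_conv, charFun_gaussianLaw hs, charFun_gaussianLaw ht,
    charFun_gaussianLaw (add_nonneg hs ht), ← Complex.exp_add]
  congr 1
  push_cast
  ring

theorem gaussianDensity_pos {s : ℝ} (hs : 0 < s) (x : EuclideanSpace ℝ (Fin n)) :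
    0 < gaussianDensity s x := by
  unfold gaussianDensity
  positivity

theorem continuous_gaussianDensity (s : ℝ) :
    Continuous (gaussianDensity s : EuclideanSpace ℝ (Fin n) → ℝ) := by
  unfold gaussianDensity
  fun_prop

theorem integrable_gaussianDensity {s : ℝ} (hs : 0 < s) :
    Integrable (gaussianDensity s : EuclideanSpace ℝ (Fin n) → ℝ) := by
  unfold gaussianDensity
  refine Integrable.const_mul ?_ _
  have h := (GaussianFourier.integrable_cexp_neg_mul_sq_norm_add
    (b := ((1 / (2 * s) : ℝ) : ℂ)) (by rw [Complex.ofReal_re]; positivity) 0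
    (0 : EuclideanSpace ℝ (Fin n))).re
  refine h.congr (Eventually.of_forall fun x => ?_)
  simp only [zero_mul, add_zero, RCLike.re_to_complex]
  rw [← Complex.ofReal_pow, ← Complex.ofReal_neg, ← Complex.ofReal_mul, Complex.exp_ofReal_re]
  congr 1
  ring

theorem integral_withDensity_ofReal {α G : Type*} [MeasurableSpace α] [NormedAddCommGroup G]
    [NormedSpace ℝ G] {m : Measure α} {u : α → ℝ} (hu : Integrable u m) (h0 : ∀ᵐ x ∂m, 0 ≤ u x)
    (F : α → G) :
    ∫ x, F x ∂(m.withDensity fun x => ENNReal.ofReal (u x)) = ∫ x, u x • F x ∂m := by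
  rw [integral_withDensity_eq_integral_toReal_smul₀ hu.aemeasurable.ennreal_ofReal
    (Eventually.of_forall fun x => ENNReal.ofReal_lt_top)]
  refine integral_congr_ae ?_
  filter_upwards [h0] with x hx
  rw [ENNReal.toReal_ofReal hx]

theorem integrable_withDensity_ofReal_iff {α G : Type*} [MeasurableSpace α] [NormedAddCommGroup G]
    [NormedSpace ℝ G] {m : Measure α} {u : α → ℝ} (hu : Integrable u m) (h0 : ∀ᵐ x ∂m, 0 ≤ u x)
    (F : α → G) :
    Integrable F (m.withDensity fun x => ENNReal.ofReal (u x)) ↔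
      Integrable (fun x => u x • F x) m := by
  rw [integrable_withDensity_iff_integrable_smul₀' hu.aemeasurable.ennreal_ofReal
    (Eventually.of_forall fun x => ENNReal.ofReal_lt_top)]
  refine integrable_congr ?_
  filter_upwards [h0] with x hx
  rw [ENNReal.toReal_ofReal hx]

theorem isFiniteMeasure_withDensity_ofReal' {α : Type*} [MeasurableSpace α] {m : Measure α}
    {u : α → ℝ} (hu : Integrable u m) :
    IsFiniteMeasure (m.withDensity fun x => ENNReal.ofReal (u x)) :=
  isFiniteMeasure_withDensity_ofReal hu.hasFiniteIntegral

theorem withDensity_gaussianDensity {s : ℝ} (hs : 0 < s) :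
    (volume.withDensity fun x => ENNReal.ofReal (gaussianDensity s x)) = gaussianLaw n s := by
  have hi := integrable_gaussianDensity (n := n) hs
  have := isFiniteMeasure_withDensity_ofReal' hi
  refine Measure.ext_of_charFun (funext fun ξ => ?_)
  rw [charFun_gaussianLaw hs.le, charFun_apply, integral_withDensity_ofReal hi
    (Eventually.of_forall fun x => (gaussianDensity_pos hs x).le)]
  have hb : (0 : ℝ) < 1 / (2 * s) := by positivity
  have h := GaussianFourier.integral_cexp_neg_mul_sq_norm_add
    (b := ((1 / (2 * s) : ℝ) : ℂ)) (by rw [Complex.ofReal_re]; exact hb) Complex.I ξ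
  have e : ∀ x : EuclideanSpace ℝ (Fin n),
      gaussianDensity s x • Complex.exp (inner ℝ x ξ * Complex.I) =
        (((1 / (2 * Real.pi * s)) ^ ((n : ℝ) / 2) : ℝ) : ℂ) *
          Complex.exp (-((1 / (2 * s) : ℝ) : ℂ) * ‖x‖ ^ 2 + Complex.I * (inner ℝ ξ x : ℝ)) := by
    intro x
    rw [gaussianDensity, Complex.real_smul, Complex.ofReal_mul, Complex.ofReal_exp, mul_assoc,
      ← Complex.exp_add, real_inner_comm]
    congr 2
    push_cast
    ring
  simp only [e]
  rw [integral_const_mul, h, ← mul_assoc, finrank_euclideanSpace_fin]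
  have e2 : ((Real.pi : ℂ) / ((1 / (2 * s) : ℝ) : ℂ)) ^ ((n : ℂ) / 2) =
      (((2 * Real.pi * s) ^ ((n : ℝ) / 2) : ℝ) : ℂ) := by
    rw [Complex.ofReal_cpow (by positivity)]
    congr 1
    · push_cast
      field_simp
    · push_cast
      rfl
  rw [e2, ← Complex.ofReal_mul, ← Real.mul_rpow (by positivity) (by positivity),
    one_div_mul_cancel (by positivity), Real.one_rpow, Complex.ofReal_one, one_mul]
  congr 1
  have : (s : ℂ) ≠ 0 := by exact_mod_cast hs.ne'
  push_cast
  rw [Complex.I_sq]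
  field_simp
  norm_num

theorem integrable_norm_sq_gaussianLaw (s : ℝ) :
    Integrable (fun x => ‖x‖ ^ 2) (gaussianLaw n s) := by
  rw [gaussianLaw, integrable_map_measure (by fun_prop) (by fun_prop)]
  have h := (IsGaussian.memLp_id (stdGaussian (EuclideanSpace ℝ (Fin n))) 2
    (by simp)).integrable_norm_pow (by simp)
  simpa [Function.comp_def, norm_smul, mul_pow] using h.const_mul (√s ^ 2)

theorem integral_norm_sq_gaussianLaw {s : ℝ} (hs : 0 ≤ s) :
    ∫ x, ‖x‖ ^ 2 ∂(gaussianLaw n s) = n * s := by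
  rw [gaussianLaw, integral_map (by fun_prop) (by fun_prop)]
  have h2 := IsGaussian.memLp_id (stdGaussian (EuclideanSpace ℝ (Fin n))) 2 (by simp)
  have hL : ∀ i : Fin n, MemLp (fun x : EuclideanSpace ℝ (Fin n) => x i) 2
      (stdGaussian (EuclideanSpace ℝ (Fin n))) := fun i =>
    (EuclideanSpace.proj (𝕜 := ℝ) i).comp_memLp' h2
  have hi : ∀ i : Fin n, ∫ x, (x i) ^ 2 ∂(stdGaussian (EuclideanSpace ℝ (Fin n))) = 1 := by
    intro i
    have hv := variance_dual_stdGaussian (innerSL ℝ (EuclideanSpace.basisFun (Fin n) ℝ i))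
    have hm := integral_strongDual_stdGaussian (innerSL ℝ (EuclideanSpace.basisFun (Fin n) ℝ i))
    rw [variance_of_integral_eq_zero (by fun_prop) hm] at hv
    simpa [EuclideanSpace.inner_single_left] using hv
  simp only [norm_smul, mul_pow, Real.norm_eq_abs, sq_abs, Real.sq_sqrt hs, integral_const_mul]
  simp only [EuclideanSpace.real_norm_sq_eq]
  rw [integral_finsetSum _ fun i _ => (hL i).integrable_sq]
  simp [hi, mul_comm]

theorem stdGaussian_prod_eq :
    stdGaussian (WithLp 2 (EuclideanSpace ℝ (Fin n) × EuclideanSpace ℝ (Fin n))) =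
      ((stdGaussian (EuclideanSpace ℝ (Fin n))).prod
        (stdGaussian (EuclideanSpace ℝ (Fin n)))).map (WithLp.toLp 2) := by
  have : IsProbabilityMeasure (((stdGaussian (EuclideanSpace ℝ (Fin n))).prod
        (stdGaussian (EuclideanSpace ℝ (Fin n)))).map (WithLp.toLp 2)) :=
    Measure.isProbabilityMeasure_map (by fun_prop)
  refine Measure.ext_of_charFun (funext fun ξ => ?_)
  rw [charFun_prod, charFun_stdGaussian, charFun_stdGaussian, charFun_stdGaussian,
    ← Complex.exp_add]
  congr 1
  have := WithLp.prod_norm_sq_eq_of_L2 ξ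
  rw [← Complex.ofReal_pow, this]
  push_cast
  simp only [WithLp.fst, WithLp.snd]
  ring

theorem integral_stdGaussian_pair {σ τ : ℝ}
    {F : EuclideanSpace ℝ (Fin n) → EuclideanSpace ℝ (Fin n) → ℝ}
    (hF : Continuous fun p : EuclideanSpace ℝ (Fin n) × EuclideanSpace ℝ (Fin n) => F p.1 p.2)
    {C : ℝ} (hC : ∀ x y, |F x y| ≤ C) :
    ∫ z, F (pairCombination _ (√σ) 0 z) (pairCombination _ (√σ) (√τ) z)
        ∂(stdGaussian (WithLp 2 (EuclideanSpace ℝ (Fin n) × EuclideanSpace ℝ (Fin n)))) =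
      ∫ x, ∫ y, F x (x + y) ∂(gaussianLaw n τ) ∂(gaussianLaw n σ) := by
  have hF1 : ∀ x, Continuous fun y => F x (x + y) := fun x =>
    hF.comp (by fun_prop : Continuous fun y => (x, x + y))
  have hc : Continuous fun x => ∫ y, F x (x + y) ∂(gaussianLaw n τ) := by
    refine continuous_of_dominated (bound := fun _ => C) (fun x => ?_) (fun x => ?_) ?_ ?_
    · exact (hF1 x).aestronglyMeasurable
    · exact Eventually.of_forall fun y => hC _ _
    · exact integrable_const _
    · exact Eventually.of_forall fun y =>
        hF.comp (by fun_prop : Continuous fun x => (x, x + y))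
  have hF2 : Continuous fun p : EuclideanSpace ℝ (Fin n) × EuclideanSpace ℝ (Fin n) =>
      F (√σ • p.1) (√σ • p.1 + √τ • p.2) :=
    hF.comp (by fun_prop : Continuous
      fun p : EuclideanSpace ℝ (Fin n) × EuclideanSpace ℝ (Fin n) =>
        (√σ • p.1, √σ • p.1 + √τ • p.2))
  have hF3 : Continuous fun z : WithLp 2 (EuclideanSpace ℝ (Fin n) × EuclideanSpace ℝ (Fin n)) =>
      F (pairCombination _ (√σ) 0 z) (pairCombination _ (√σ) (√τ) z) :=
    hF.comp (by fun_prop : Continuous fun z => (pairCombination (EuclideanSpace ℝ (Fin n)) (√σ) 0 z,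
      pairCombination (EuclideanSpace ℝ (Fin n)) (√σ) (√τ) z))
  rw [stdGaussian_prod_eq, integral_map (by fun_prop) hF3.aestronglyMeasurable]
  simp only [pairCombination_apply, zero_smul, add_zero]
  rw [integral_prod]
  · rw [gaussianLaw, gaussianLaw] at *
    rw [integral_map (by fun_prop) hc.aestronglyMeasurable]
    congr 1
    ext x
    rw [integral_map (by fun_prop) (hF1 _).aestronglyMeasurable]
    rfl
  · exact Integrable.of_bound hF2.aestronglyMeasurable C (Eventually.of_forall fun p => hC _ _)

/-- Integrated hypercontractivity: the Gaussian averaging operator with `σ` replaced by `σ + τ`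
contracts exponential moments. -/
theorem gaussian_exp_average_le {σ τ : ℝ} (hσ : 0 < σ) (hτ : 0 < τ)
    (g : EuclideanSpace ℝ (Fin n) →ᵇ ℝ) :
    σ / (σ + τ) * Real.log (∫ x, Real.exp
        ((σ / (σ + τ))⁻¹ * ∫ y, g (x + y) ∂(gaussianLaw n τ)) ∂(gaussianLaw n σ)) ≤
      Real.log (∫ x, Real.exp (g x) ∂(gaussianLaw n (σ + τ))) := by
  have hst : 0 < σ + τ := by positivity
  obtain ⟨c, hc⟩ : ∃ c, c = σ / (σ + τ) := ⟨_, rfl⟩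
  have hc0 : 0 < c := by rw [hc]; positivity
  have hsd := sdpi_stdGaussian (n := n) (Real.sqrt_pos.mpr hσ) (Real.sqrt_pos.mpr hτ)
    (Real.sqrt_pos.mpr hst) (by rw [Real.sq_sqrt hσ.le, Real.sq_sqrt hτ.le, Real.sq_sqrt hst.le])
  rw [div_pow, Real.sq_sqrt hσ.le, Real.sq_sqrt hst.le, ← hc] at hsd
  rw [← hc]
  set P := g.average (gaussianLaw n τ) id continuous_id with hP
  -- With `f = exp (P / c)` one has `c f log f = f P`, so the integrals of `f P` on both sides
  -- cancel and only `c log ∫ f` and `log ∫ exp g` remain.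
  set f := P.postcomp (fun r => Real.exp (c⁻¹ * r)) (by fun_prop) with hf
  have hbd : ∀ F : EuclideanSpace ℝ (Fin n) →ᵇ ℝ, ∀ x, |F x| ≤ ‖F‖ := fun F x =>
    F.norm_coe_le_norm x
  have hfl := hsd f g fun x => (Real.exp_pos _).le
  have marg : ∀ F : EuclideanSpace ℝ (Fin n) →ᵇ ℝ,
      ∫ z, F (pairCombination _ (√σ) 0 z)
        ∂(stdGaussian (WithLp 2 (EuclideanSpace ℝ (Fin n) × EuclideanSpace ℝ (Fin n)))) =
      ∫ x, F x ∂(gaussianLaw n σ) := by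
    intro F
    rw [integral_stdGaussian_pair (τ := τ) (F := fun x _ => F x) (by fun_prop)
      (fun x _ => hbd F x)]
    simp
  have e1 : ∫ z, f (pairCombination _ (√σ) 0 z) * g (pairCombination _ (√σ) (√τ) z)
        ∂(stdGaussian (WithLp 2 (EuclideanSpace ℝ (Fin n) × EuclideanSpace ℝ (Fin n)))) =
      ∫ x, f x * P x ∂(gaussianLaw n σ) := by
    rw [integral_stdGaussian_pair (F := fun x y => f x * g y) (by fun_prop) (C := ‖f‖ * ‖g‖)]
    · simp only [integral_const_mul]
      rfl
    · intro x y
      rw [abs_mul]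
      exact mul_le_mul (hbd f x) (hbd g y) (abs_nonneg _) (norm_nonneg _)
  have e2 : ∫ z, Real.exp (g (pairCombination _ (√σ) (√τ) z))
        ∂(stdGaussian (WithLp 2 (EuclideanSpace ℝ (Fin n) × EuclideanSpace ℝ (Fin n)))) =
      ∫ x, Real.exp (g x) ∂(gaussianLaw n (σ + τ)) := by
    rw [integral_stdGaussian_pair (F := fun _ y => Real.exp (g y)) (by fun_prop)
      (fun _ y => hbd (g.postcomp _ Real.continuous_exp) y), ← gaussianLaw_conv hσ.le hτ.le]
    exact (integral_conv ((g.postcomp _ Real.continuous_exp).integrable _)).symm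
  have e3 : ∫ z, f (pairCombination _ (√σ) 0 z) * Real.log (f (pairCombination _ (√σ) 0 z))
        ∂(stdGaussian (WithLp 2 (EuclideanSpace ℝ (Fin n) × EuclideanSpace ℝ (Fin n)))) =
      c⁻¹ * ∫ x, f x * P x ∂(gaussianLaw n σ) := by
    refine (marg (f.postcomp _ Real.continuous_mul_log)).trans ?_
    rw [← integral_const_mul]
    congr 1
    ext x
    simp only [hf, BoundedContinuousFunction.postcomp_apply, Real.log_exp]
    ring
  rw [e1, e2, e3, marg f, mul_sub, mul_inv_cancel_left₀ hc0.ne'] at hfl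
  have hm : 0 < ∫ x, f x ∂(gaussianLaw n σ) :=
    integral_exp_pos (f := fun x => c⁻¹ * P x) (f.integrable _)
  have h4 : (∫ x, f x ∂(gaussianLaw n σ)) * (c * Real.log (∫ x, f x ∂(gaussianLaw n σ))) ≤
      (∫ x, f x ∂(gaussianLaw n σ)) *
        Real.log (∫ x, Real.exp (g x) ∂(gaussianLaw n (σ + τ))) := by
    linarith
  exact le_of_mul_le_mul_left h4 hm

end

/-! ### From duality back to relative entropy -/

section
variable {n : ℕ}

theorem integral_gaussianLaw {s : ℝ} (hs : 0 < s) (F : EuclideanSpace ℝ (Fin n) → ℝ) :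
    ∫ x, F x ∂(gaussianLaw n s) = ∫ x, gaussianDensity s x * F x := by
  rw [← withDensity_gaussianDensity hs, integral_withDensity_ofReal (integrable_gaussianDensity hs)
    (Eventually.of_forall fun x => (gaussianDensity_pos hs x).le)]
  simp

theorem integral_gaussianDensity {s : ℝ} (hs : 0 < s) :
    ∫ x : EuclideanSpace ℝ (Fin n), gaussianDensity s x = 1 := by
  have := integral_gaussianLaw (n := n) hs fun _ => 1
  simpa using this.symm

/-- Gibbs variational principle for bounded continuous test functions. -/
theorem integral_mul_le_relEntropy_add {σ : ℝ} (hσ : 0 < σ)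
    {u : EuclideanSpace ℝ (Fin n) → ℝ} (hu : Integrable u) (hu0 : ∀ᵐ x, 0 ≤ u x)
    (hu1 : ∫ x, u x = 1) (hH : Integrable (relEntropyIntegrand u (gaussianDensity σ)))
    (k : EuclideanSpace ℝ (Fin n) →ᵇ ℝ) :
    ∫ x, u x * k x ≤ relEntropy u (gaussianDensity σ) +
      Real.log (∫ x, Real.exp (k x) ∂(gaussianLaw n σ)) := by
  obtain ⟨Z, hZ⟩ : ∃ Z, Z = ∫ x, Real.exp (k x) ∂(gaussianLaw n σ) := ⟨_, rfl⟩
  have hZ0 : 0 < Z := by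
    rw [hZ]
    exact integral_exp_pos ((k.postcomp _ Real.continuous_exp).integrable _)
  have hi1 : Integrable fun x => u x * k x :=
    hu.mul_bdd (c := ‖k‖) k.continuous.aestronglyMeasurable
      (Eventually.of_forall fun x => k.norm_coe_le_norm x)
  have hi2 : Integrable fun x => gaussianDensity σ x * Real.exp (k x) :=
    (integrable_gaussianDensity hσ).mul_bdd (c := ‖k.postcomp _ Real.continuous_exp‖)
      (Real.continuous_exp.comp k.continuous).aestronglyMeasurable
      (Eventually.of_forall fun x => (k.postcomp _ Real.continuous_exp).norm_coe_le_norm x)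
  have hpt : ∀ᵐ x, u x * k x ≤ relEntropyIntegrand u (gaussianDensity σ) x +
      (Real.log Z - 1) * u x + Z⁻¹ * (gaussianDensity σ x * Real.exp (k x)) := by
    filter_upwards [hu0] with x hx
    have hg := gaussianDensity_pos hσ x
    -- Comparison with the tilted probability density `M_σ exp k / Z`, where `Z` normalises.
    have h := sub_le_mul_log_div hx
      (show 0 < gaussianDensity σ x * Real.exp (k x) / Z by positivity)
    rcases hx.eq_or_lt with h0 | h0
    · simp only [relEntropyIntegrand, ← h0]
      simp only [zero_mul, mul_zero, zero_add]
      positivity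
    · rw [Real.log_div h0.ne' (by positivity), Real.log_div (by positivity) hZ0.ne',
        Real.log_mul hg.ne' (Real.exp_pos _).ne', Real.log_exp] at h
      rw [relEntropyIntegrand, Real.log_div h0.ne' hg.ne']
      have e : gaussianDensity σ x * Real.exp (k x) / Z =
        Z⁻¹ * (gaussianDensity σ x * Real.exp (k x)) := by ring
      rw [e] at h
      linarith
  have hint := integral_mono_ae hi1 ((hH.add (hu.const_mul (Real.log Z - 1))).add
    (hi2.const_mul Z⁻¹)) hpt
  have e : ∫ x, (relEntropyIntegrand u (gaussianDensity σ) x +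
      (Real.log Z - 1) * u x + Z⁻¹ * (gaussianDensity σ x * Real.exp (k x))) =
      relEntropy u (gaussianDensity σ) + Real.log Z := by
    refine (integral_add (hH.add (hu.const_mul (Real.log Z - 1))) (hi2.const_mul Z⁻¹)).trans ?_
    rw [integral_add' hH (hu.const_mul (Real.log Z - 1)), integral_const_mul, integral_const_mul, hu1,
      ← integral_gaussianLaw hσ, ← hZ, inv_mul_cancel₀ hZ0.ne', relEntropy]
    ring
  rw [← hZ]
  exact hint.trans_eq e

/-- Entropy contraction tested against a bounded continuous function. -/
theorem integral_conv_gaussianLaw_le {σ τ : ℝ} (hσ : 0 < σ) (hτ : 0 < τ)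
    {u : EuclideanSpace ℝ (Fin n) → ℝ} (hu : Integrable u) (hu0 : ∀ᵐ x, 0 ≤ u x)
    (hu1 : ∫ x, u x = 1) (hH : Integrable (relEntropyIntegrand u (gaussianDensity σ)))
    (g : EuclideanSpace ℝ (Fin n) →ᵇ ℝ) :
    ∫ x, g x ∂((volume.withDensity fun x => ENNReal.ofReal (u x)) ∗ gaussianLaw n τ) ≤
      σ / (σ + τ) * relEntropy u (gaussianDensity σ) +
        Real.log (∫ x, Real.exp (g x) ∂(gaussianLaw n (σ + τ))) := by
  have := isFiniteMeasure_withDensity_ofReal' hu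
  have h1 := gaussian_exp_average_le hσ hτ g
  obtain ⟨c, hc⟩ : ∃ c, c = σ / (σ + τ) := ⟨_, rfl⟩
  have hc0 : 0 < c := by rw [hc]; positivity
  rw [← hc] at h1 ⊢
  -- Testing with `c⁻¹` times the Gaussian average of `g` makes the exponential moment match `h1`;
  -- multiplying through by `c` then leaves the factor `c` on the entropy.
  have h2 := integral_mul_le_relEntropy_add hσ hu hu0 hu1 hH
    ((g.average (gaussianLaw n τ) id continuous_id).postcomp (fun r => c⁻¹ * r) (by fun_prop))
  rw [integral_conv (g.integrable _), integral_withDensity_ofReal hu hu0]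
  simp only [BoundedContinuousFunction.postcomp_apply, BoundedContinuousFunction.average_apply,
    id_eq] at h2
  have e : ∫ x, u x * (c⁻¹ * ∫ y, g (x + y) ∂(gaussianLaw n τ)) =
      c⁻¹ * ∫ x, u x • ∫ y, g (x + y) ∂(gaussianLaw n τ) := by
    rw [← integral_const_mul]
    congr 1
    ext x
    simp only [smul_eq_mul]
    ring
  rw [e] at h2
  have h3 := mul_le_mul_of_nonneg_left h2 hc0.le
  rw [mul_inv_cancel_left₀ hc0.ne'] at h3
  linarith

/-- The logarithm of `r` truncated to `[exp (-k), exp k]`. -/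
noncomputable def truncLog (k r : ℝ) : ℝ := Real.log (max (Real.exp (-k)) (min (Real.exp k) r))

theorem truncLog_arg_pos (k r : ℝ) : 0 < max (Real.exp (-k)) (min (Real.exp k) r) :=
  lt_max_of_lt_left (Real.exp_pos _)

theorem continuous_truncLog (k : ℝ) : Continuous (truncLog k) :=
  Continuous.log (by fun_prop) fun r => (truncLog_arg_pos k r).ne'

theorem abs_truncLog_le {k : ℝ} (hk : 0 ≤ k) (r : ℝ) : |truncLog k r| ≤ k := by
  rw [abs_le, truncLog]
  constructor
  · exact (Real.le_log_iff_exp_le (truncLog_arg_pos k r)).mpr (le_max_left _ _)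
  · refine (Real.log_le_iff_le_exp (truncLog_arg_pos k r)).mpr (max_le ?_ (min_le_left _ _))
    exact Real.exp_le_exp.mpr (by linarith)

theorem exp_truncLog_le {k r : ℝ} (hr : 0 ≤ r) :
    Real.exp (truncLog k r) ≤ r + Real.exp (-k) := by
  rw [truncLog, Real.exp_log (truncLog_arg_pos k r)]
  refine max_le (by linarith) ((min_le_right _ _).trans ?_)
  linarith [Real.exp_pos (-k)]

/-- For `r ≤ 1` truncation can only raise the logarithm, and `r log r ≥ r - 1`. The bound is uniform
in `k`, which is what Fatou's lemma needs. -/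
theorem neg_one_le_mul_truncLog {k r : ℝ} (hk : 0 ≤ k) (hr : 0 ≤ r) : -1 ≤ r * truncLog k r := by
  rcases le_total r 1 with h | h
  · rcases hr.eq_or_lt with rfl | hr
    · simp
    have h1 := sub_le_mul_log_div hr.le one_pos
    rw [div_one] at h1
    refine (by linarith : -1 ≤ r - 1).trans
      (h1.trans (mul_le_mul_of_nonneg_left ?_ hr.le))
    exact Real.log_le_log hr (le_max_of_le_right (le_min (h.trans (Real.one_le_exp hk)) le_rfl))
  · have : 0 ≤ truncLog k r :=
      Real.log_nonneg (le_max_of_le_right (le_min (Real.one_le_exp hk) h))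
    linarith [mul_nonneg hr this]

theorem tendsto_mul_truncLog {r : ℝ} (hr : 0 ≤ r) :
    Tendsto (fun k : ℕ => r * truncLog k r) atTop (𝓝 (r * Real.log r)) := by
  rcases hr.eq_or_lt with rfl | hr
  · simp
  · refine tendsto_const_nhds.congr' ?_
    filter_upwards [eventually_ge_atTop ⌈|Real.log r|⌉₊] with k hk
    have h1 : |Real.log r| ≤ k := (Nat.le_ceil _).trans (by exact_mod_cast hk)
    obtain ⟨h2, h3⟩ := abs_le.mp h1
    rw [truncLog, min_eq_right ((Real.log_le_iff_le_exp hr).mp h3),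
      max_eq_right ((Real.le_log_iff_exp_le hr).mp h2)]

/-- Entropy contraction along the heat flow. -/
theorem relEntropy_conv_gaussianLaw_le {σ τ : ℝ} (hσ : 0 < σ) (hτ : 0 < τ)
    {u : EuclideanSpace ℝ (Fin n) → ℝ} (hu : Integrable u) (hu0 : ∀ᵐ x, 0 ≤ u x)
    (hu1 : ∫ x, u x = 1) (hH : Integrable (relEntropyIntegrand u (gaussianDensity σ)))
    {w : EuclideanSpace ℝ (Fin n) → ℝ} (hwc : Continuous w) (hw : Integrable w)
    (hw0 : ∀ x, 0 ≤ w x)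
    (hwu : (volume.withDensity fun x => ENNReal.ofReal (w x)) =
      (volume.withDensity fun x => ENNReal.ofReal (u x)) ∗ gaussianLaw n τ) :
    Integrable (relEntropyIntegrand w (gaussianDensity (σ + τ))) ∧
      relEntropy w (gaussianDensity (σ + τ)) ≤
        σ / (σ + τ) * relEntropy u (gaussianDensity σ) := by
  have hst : 0 < σ + τ := by positivity
  obtain ⟨H, hHdef⟩ : ∃ H, H = σ / (σ + τ) * relEntropy u (gaussianDensity σ) := ⟨_, rfl⟩
  set m : EuclideanSpace ℝ (Fin n) → ℝ := gaussianDensity (σ + τ) with hm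
  have hm0 : ∀ x, 0 < m x := gaussianDensity_pos hst
  have hmc : Continuous m := continuous_gaussianDensity _
  have hmi : Integrable m := integrable_gaussianDensity hst
  have hm1 : ∫ x, m x = 1 := integral_gaussianDensity hst
  have hrc : Continuous fun x => w x / m x := hwc.div hmc fun x => (hm0 x).ne'
  have hw0' : ∀ᵐ x, 0 ≤ w x := Eventually.of_forall hw0
  -- The optimal test function is `log (w / m)`; truncation makes it bounded and so admissible.
  let g : ℕ → (EuclideanSpace ℝ (Fin n) →ᵇ ℝ) := fun k =>
    BoundedContinuousFunction.ofNormedAddCommGroup (fun x => truncLog k (w x / m x))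
      ((continuous_truncLog k).comp hrc) k (fun x => abs_truncLog_le (Nat.cast_nonneg k) _)
  have hgi : ∀ k, Integrable fun x => w x * g k x := fun k =>
    hw.mul_bdd (c := ‖g k‖) (g k).continuous.aestronglyMeasurable
      (Eventually.of_forall fun x => (g k).norm_coe_le_norm x)
  have hw1 : ∫ x, w x = 1 := by
    have := isFiniteMeasure_withDensity_ofReal' hu
    have h1 := integral_withDensity_ofReal hw hw0' fun _ => (1 : ℝ)
    rw [hwu, integral_conv (integrable_const _)] at h1
    simp only [integral_const, probReal_univ, smul_eq_mul, mul_one] at h1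
    have h2 := integral_withDensity_ofReal hu hu0 fun _ => (1 : ℝ)
    simp only [integral_const, smul_eq_mul, mul_one] at h2
    rw [← h1, h2, hu1]
  have hwm : ∀ x, w x = m x * (w x / m x) := fun x => by
    rw [mul_div_cancel₀ _ (hm0 x).ne']
  have hr0 : ∀ x, 0 ≤ w x / m x := fun x => div_nonneg (hw0 x) (hm0 x).le
  have hbound : ∀ k : ℕ, ∫ x, (w x * g k x + m x) ≤ H + Real.exp (-k) + 1 := by
    intro k
    have h1 := integral_conv_gaussianLaw_le hσ hτ hu hu0 hu1 hH (g k)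
    rw [← hwu, integral_withDensity_ofReal hw hw0', ← hHdef] at h1
    -- The lower truncation raises `w / m` by at most `exp (-k)`, so the exponential moment exceeds
    -- the mass of `w` by at most `exp (-k)`.
    have h2 : ∫ x, Real.exp (g k x) ∂(gaussianLaw n (σ + τ)) ≤ 1 + Real.exp (-k) := by
      rw [integral_gaussianLaw hst]
      have h3 : ∫ x, (w x + Real.exp (-k) * m x) = 1 + Real.exp (-k) := by
        rw [integral_add hw (hmi.const_mul _), integral_const_mul, hw1, hm1, mul_one]
      rw [← h3]
      refine integral_mono ?_ (hw.add (hmi.const_mul _)) fun x => ?_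
      · exact hmi.mul_bdd (c := ‖(g k).postcomp _ Real.continuous_exp‖)
          (Real.continuous_exp.comp (g k).continuous).aestronglyMeasurable
          (Eventually.of_forall fun x =>
            ((g k).postcomp _ Real.continuous_exp).norm_coe_le_norm x)
      · have := mul_le_mul_of_nonneg_left (exp_truncLog_le (k := k) (hr0 x)) (hm0 x).le
        rw [mul_add, ← hwm] at this
        refine this.trans_eq ?_
        ring
    have hpos : 0 < ∫ x, Real.exp (g k x) ∂(gaussianLaw n (σ + τ)) :=
      integral_exp_pos (((g k).postcomp _ Real.continuous_exp).integrable _)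
    have h4 := Real.log_le_sub_one_of_pos hpos
    rw [integral_add (hgi k) hmi, hm1]
    simp only [smul_eq_mul] at h1
    linarith
  -- Adding `m` makes the truncated integrands nonnegative, so Fatou's lemma gives both
  -- integrability of the limit and the bound; the unit mass of `m` is subtracted at the end.
  let h : ℕ → EuclideanSpace ℝ (Fin n) → ℝ := fun k x => w x * g k x + m x
  let hl : EuclideanSpace ℝ (Fin n) → ℝ := fun x => relEntropyIntegrand w m x + m x
  have hh0 : ∀ k x, 0 ≤ h k x := by
    intro k x
    have := mul_le_mul_of_nonneg_left
      (neg_one_le_mul_truncLog (k := k) (Nat.cast_nonneg k) (hr0 x)) (hm0 x).le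
    rw [← mul_assoc, ← hwm] at this
    change 0 ≤ w x * truncLog k (w x / m x) + m x
    linarith
  have hlim : ∀ x, Tendsto (fun k => h k x) atTop (𝓝 (hl x)) := by
    intro x
    have := ((tendsto_mul_truncLog (hr0 x)).const_mul (m x)).add_const (m x)
    simp only [← mul_assoc, ← hwm] at this
    exact this
  have hl0 : ∀ x, 0 ≤ hl x := fun x => ge_of_tendsto' (hlim x) fun k => hh0 k x
  have hhi : ∀ k, Integrable (h k) := fun k => (hgi k).add hmi
  have hlm : AEStronglyMeasurable hl volume :=
    aestronglyMeasurable_of_tendsto_ae atTop (fun k => (hhi k).aestronglyMeasurable)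
      (Eventually.of_forall hlim)
  have hexp : Tendsto (fun k : ℕ => H + Real.exp (-(k : ℝ)) + 1) atTop (𝓝 (H + 1)) := by
    have := ((Real.tendsto_exp_neg_atTop_nhds_zero.comp tendsto_natCast_atTop_atTop).const_add
      H).add_const 1
    simpa using this
  have hH1 : 0 ≤ H + 1 :=
    ge_of_tendsto' hexp fun k => (integral_nonneg (hh0 k)).trans (hbound k)
  have hfatou : ∫⁻ x, ENNReal.ofReal (hl x) ≤ ENNReal.ofReal (H + 1) := by
    have e : ∀ x, ENNReal.ofReal (hl x) = liminf (fun k => ENNReal.ofReal (h k x)) atTop :=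
      fun x => ((ENNReal.continuous_ofReal.tendsto _).comp (hlim x)).liminf_eq.symm
    simp only [e]
    refine (lintegral_liminf_le' fun k => (hhi k).aemeasurable.ennreal_ofReal).trans ?_
    rw [← ((ENNReal.continuous_ofReal.tendsto _).comp hexp).liminf_eq]
    refine liminf_le_liminf (Eventually.of_forall fun k => ?_)
    rw [← ofReal_integral_eq_lintegral_ofReal (hhi k) (Eventually.of_forall (hh0 k))]
    exact ENNReal.ofReal_le_ofReal (hbound k)
  have hli : Integrable hl := by
    refine ⟨hlm, ?_⟩
    rw [hasFiniteIntegral_iff_ofReal (Eventually.of_forall hl0)]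
    exact hfatou.trans_lt ENNReal.ofReal_lt_top
  have hle : ∫ x, hl x ≤ H + 1 := by
    rw [integral_eq_lintegral_of_nonneg_ae (Eventually.of_forall hl0) hlm]
    exact ENNReal.toReal_le_of_le_ofReal hH1 hfatou
  have hri : Integrable (relEntropyIntegrand w m) := by
    exact (hli.sub hmi).congr (Eventually.of_forall fun x => by simp [hl])
  refine ⟨hri, ?_⟩
  have : ∫ x, hl x = relEntropy w m + 1 := by
    rw [← hm1]
    exact integral_add hri hmi
  rw [← hHdef]
  linarith

end

/-! ### Laplacian identities and cut-off plane waves -/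

section
variable {n : ℕ}

local notation "E" => EuclideanSpace ℝ (Fin n)

theorem ContDiff.fderiv_apply_one {f : E → ℝ} (hf : ContDiff ℝ 2 f) (e : E) :
    ContDiff ℝ 1 fun x => fderiv ℝ f x e :=
  (hf.fderiv_right (m := 1) (by norm_num)).clm_apply contDiff_const

theorem ContDiff.continuous_fderiv_fderiv {f : E → ℝ} (hf : ContDiff ℝ 2 f) (e : E) :
    Continuous fun x => fderiv ℝ (fun y => fderiv ℝ f y e) x e :=
  ((hf.fderiv_apply_one e).continuous_fderiv (by norm_num)).clm_apply continuous_const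

theorem laplacian_eq_sum_fderiv {f : E → ℝ} (hf : ContDiff ℝ 2 f) (x : E) :
    Laplacian.laplacian f x = ∑ i, fderiv ℝ (fun y => fderiv ℝ f y
      (EuclideanSpace.basisFun (Fin n) ℝ i)) x (EuclideanSpace.basisFun (Fin n) ℝ i) := by
  rw [InnerProductSpace.laplacian_eq_iteratedFDeriv_orthonormalBasis f
    (EuclideanSpace.basisFun (Fin n) ℝ)]
  refine Finset.sum_congr rfl fun i _ => ?_
  have hd : DifferentiableAt ℝ (fderiv ℝ f) x :=
    ((hf.fderiv_right (m := 1) (by norm_num)).differentiable (by norm_num)) x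
  rw [iteratedFDeriv_two_apply, fderiv_clm_apply hd (differentiableAt_const _)]
  simp

/-- Green's second identity against a compactly supported function. -/
theorem integral_laplacian_mul_eq {v ψ : E → ℝ} (hv : ContDiff ℝ 2 v) (hψ : ContDiff ℝ 2 ψ)
    (hc : HasCompactSupport ψ) :
    ∫ x, Laplacian.laplacian v x * ψ x = ∫ x, v x * Laplacian.laplacian ψ x := by
  have d1 : ∀ {f : E → ℝ}, ContDiff ℝ 2 f → ∀ x, DifferentiableAt ℝ f x := fun hf x =>
    hf.differentiable (by norm_num) x
  have d2 : ∀ {f : E → ℝ}, ContDiff ℝ 2 f → ∀ e x,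
      DifferentiableAt ℝ (fun y => fderiv ℝ f y e) x := fun hf e x =>
    (hf.fderiv_apply_one e).differentiable (by norm_num) x
  have c1 : ∀ e, HasCompactSupport fun y => fderiv ℝ ψ y e := fun e => hc.fderiv_apply ℝ e
  have c2 : ∀ e, HasCompactSupport fun y => fderiv ℝ (fun z => fderiv ℝ ψ z e) y e := fun e =>
    (c1 e).fderiv_apply ℝ e
  have i1 : ∀ e, Integrable fun x => fderiv ℝ (fun y => fderiv ℝ v y e) x e * ψ x := fun e =>
    ((hv.continuous_fderiv_fderiv e).mul hψ.continuous).integrable_of_hasCompactSupport hc.mul_left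
  have i2 : ∀ e, Integrable fun x => v x * fderiv ℝ (fun y => fderiv ℝ ψ y e) x e := fun e =>
    (hv.continuous.mul (hψ.continuous_fderiv_fderiv e)).integrable_of_hasCompactSupport
      (c2 e).mul_left
  have i3 : ∀ e, Integrable fun x => fderiv ℝ v x e * fderiv ℝ ψ x e := fun e =>
    ((hv.fderiv_apply_one e).continuous.mul
      (hψ.fderiv_apply_one e).continuous).integrable_of_hasCompactSupport (c1 e).mul_left
  have i4 : ∀ e, Integrable fun x => fderiv ℝ v x e * ψ x := fun e =>
    ((hv.fderiv_apply_one e).continuous.mul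
      hψ.continuous).integrable_of_hasCompactSupport hc.mul_left
  have i5 : ∀ e, Integrable fun x => v x * fderiv ℝ ψ x e := fun e =>
    (hv.continuous.mul
      (hψ.fderiv_apply_one e).continuous).integrable_of_hasCompactSupport (c1 e).mul_left
  simp only [laplacian_eq_sum_fderiv hv, laplacian_eq_sum_fderiv hψ, Finset.sum_mul,
    Finset.mul_sum]
  rw [integral_finsetSum _ fun i _ => i1 _, integral_finsetSum _ fun i _ => i2 _]
  refine Finset.sum_congr rfl fun i _ => ?_
  rw [integral_mul_fderiv_eq_neg_fderiv_mul_of_integrable (i3 _) (i2 _) (i5 _)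
    (fun x _ => d1 hv x) (fun x _ => d2 hψ _ x),
    integral_mul_fderiv_eq_neg_fderiv_mul_of_integrable (i1 _) (i3 _) (i4 _)
    (fun x _ => d2 hv _ x) (fun x _ => d1 hψ x), neg_neg]

theorem laplacian_mul {f g : E → ℝ} (hf : ContDiff ℝ 2 f) (hg : ContDiff ℝ 2 g) (x : E) :
    Laplacian.laplacian (fun y => f y * g y) x =
      f x * Laplacian.laplacian g x + g x * Laplacian.laplacian f x +
        2 * ∑ i, fderiv ℝ f x (EuclideanSpace.basisFun (Fin n) ℝ i) *
          fderiv ℝ g x (EuclideanSpace.basisFun (Fin n) ℝ i) := by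
  have d1 : ∀ {f : E → ℝ}, ContDiff ℝ 2 f → ∀ x, DifferentiableAt ℝ f x := fun hf x =>
    hf.differentiable (by norm_num) x
  have d2 : ∀ {f : E → ℝ}, ContDiff ℝ 2 f → ∀ e x,
      DifferentiableAt ℝ (fun y => fderiv ℝ f y e) x := fun hf e x =>
    (hf.fderiv_apply_one e).differentiable (by norm_num) x
  rw [laplacian_eq_sum_fderiv (hf.mul hg), laplacian_eq_sum_fderiv hf, laplacian_eq_sum_fderiv hg,
    Finset.mul_sum, Finset.mul_sum, Finset.mul_sum, ← Finset.sum_add_distrib,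
    ← Finset.sum_add_distrib]
  refine Finset.sum_congr rfl fun i _ => ?_
  obtain ⟨e, he⟩ : ∃ e, e = EuclideanSpace.basisFun (Fin n) ℝ i := ⟨_, rfl⟩
  rw [← he]
  have h1 : (fun y => fderiv ℝ (fun z => f z * g z) y e) =
      fun y => f y * fderiv ℝ g y e + g y * fderiv ℝ f y e := by
    ext y
    rw [fderiv_fun_mul (d1 hf y) (d1 hg y)]
    simp
  rw [h1, fderiv_fun_add ((d1 hf x).fun_mul (d2 hg e x)) ((d1 hg x).fun_mul (d2 hf e x)),
    fderiv_fun_mul (d1 hf x) (d2 hg e x), fderiv_fun_mul (d1 hg x) (d2 hf e x)]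
  simp
  ring

theorem fderiv_comp_const_smul_apply {f : E → ℝ} (hf : Differentiable ℝ f) (r : ℝ) (x e : E) :
    fderiv ℝ (fun y => f (r • y)) x e = r * fderiv ℝ f (r • x) e := by
  have h1 : HasFDerivAt (fun y : E => r • y) (r • ContinuousLinearMap.id ℝ E) x :=
    (hasFDerivAt_id x).const_smul r
  have := ((hf (r • x)).hasFDerivAt.comp x h1).fderiv
  simp only [Function.comp_def] at this
  rw [this]
  simp

theorem laplacian_comp_const_smul {f : E → ℝ} (hf : ContDiff ℝ 2 f) (r : ℝ) (x : E) :
    Laplacian.laplacian (fun y => f (r • y)) x = r ^ 2 * Laplacian.laplacian f (r • x) := by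
  have h0 : ContDiff ℝ 2 fun y : E => f (r • y) := hf.comp (contDiff_const_smul r)
  rw [laplacian_eq_sum_fderiv h0, laplacian_eq_sum_fderiv hf, Finset.mul_sum]
  refine Finset.sum_congr rfl fun i _ => ?_
  simp only [fderiv_comp_const_smul_apply (hf.differentiable (by norm_num))]
  have hd : Differentiable ℝ fun y => fderiv ℝ f y (EuclideanSpace.basisFun (Fin n) ℝ i) :=
    (hf.fderiv_apply_one _).differentiable (by norm_num)
  have hd' : DifferentiableAt ℝ
      (fun y => fderiv ℝ f (r • y) (EuclideanSpace.basisFun (Fin n) ℝ i)) x :=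
    (hd.comp (differentiable_id.const_smul r)) x
  rw [fderiv_const_mul hd']
  simp only [smul_apply, smul_eq_mul]
  rw [fderiv_comp_const_smul_apply hd]
  ring

theorem contDiff_cos_inner (ξ : E) (θ : ℝ) :
    ContDiff ℝ 2 fun x : E => Real.cos (inner ℝ ξ x + θ) := by
  exact Real.contDiff_cos.comp ((innerSL ℝ ξ).contDiff.add contDiff_const)

theorem fderiv_cos_inner (ξ : E) (θ : ℝ) (x e : E) :
    fderiv ℝ (fun x : E => Real.cos (inner ℝ ξ x + θ)) x e =
      -Real.sin (inner ℝ ξ x + θ) * inner ℝ ξ e := by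
  have h : HasFDerivAt (fun x : E => inner ℝ ξ x + θ) (innerSL ℝ ξ) x :=
    ((innerSL ℝ ξ).hasFDerivAt).add_const θ
  rw [h.cos.fderiv]
  simp

theorem laplacian_cos_inner (ξ : E) (θ : ℝ) (x : E) :
    Laplacian.laplacian (fun x : E => Real.cos (inner ℝ ξ x + θ)) x =
      -‖ξ‖ ^ 2 * Real.cos (inner ℝ ξ x + θ) := by
  have h : HasFDerivAt (fun x : E => inner ℝ ξ x + θ) (innerSL ℝ ξ) x :=
    ((innerSL ℝ ξ).hasFDerivAt).add_const θ
  rw [laplacian_eq_sum_fderiv (contDiff_cos_inner ξ θ),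
    ← (EuclideanSpace.basisFun (Fin n) ℝ).sum_sq_inner_right ξ, neg_mul, Finset.sum_mul,
    ← Finset.sum_neg_distrib]
  refine Finset.sum_congr rfl fun i _ => ?_
  simp only [fderiv_cos_inner]
  rw [((h.sin.fun_neg).mul_const _).fderiv]
  simp [real_inner_comm]
  ring

/-- Cutting off the plane wave at scale `1 / r` perturbs the eigenvalue equation by `O(r)`. -/
theorem exists_cutoff_bound {χ : E → ℝ} (hχ : ContDiff ℝ 2 χ) (hc : HasCompactSupport χ) (ξ : E)
    (θ : ℝ) : ∃ C, ∀ r : ℝ, 0 ≤ r → r ≤ 1 → ∀ x : E,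
      |Laplacian.laplacian (fun y : E => χ (r • y) * Real.cos (inner ℝ ξ y + θ)) x
        + ‖ξ‖ ^ 2 * (χ (r • x) * Real.cos (inner ℝ ξ x + θ))| ≤ C * r := by
  have hb1 : ∀ i, ∃ C, ∀ x, ‖fderiv ℝ χ x (EuclideanSpace.basisFun (Fin n) ℝ i)‖ ≤ C := fun i =>
    (hχ.fderiv_apply_one _).continuous.bounded_above_of_compact_support (hc.fderiv_apply ℝ _)
  have hb2 : ∀ i, ∃ C, ∀ x, ‖fderiv ℝ (fun y => fderiv ℝ χ y
      (EuclideanSpace.basisFun (Fin n) ℝ i)) x (EuclideanSpace.basisFun (Fin n) ℝ i)‖ ≤ C :=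
    fun i => (hχ.continuous_fderiv_fderiv _).bounded_above_of_compact_support
      ((hc.fderiv_apply ℝ _).fderiv_apply ℝ _)
  choose C1 hC1 using hb1
  choose C2 hC2 using hb2
  refine ⟨∑ i, C2 i + 2 * ∑ i, C1 i * |inner ℝ ξ (EuclideanSpace.basisFun (Fin n) ℝ i)|,
    fun r hr0 hr1 x => ?_⟩
  have hχr : ContDiff ℝ 2 fun y : E => χ (r • y) := hχ.comp (contDiff_const_smul r)
  rw [laplacian_mul hχr (contDiff_cos_inner ξ θ), laplacian_cos_inner,
    laplacian_comp_const_smul hχ]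
  simp only [fderiv_comp_const_smul_apply (hχ.differentiable (by norm_num)), fderiv_cos_inner]
  have hL : |Laplacian.laplacian χ (r • x)| ≤ ∑ i, C2 i := by
    rw [laplacian_eq_sum_fderiv hχ]
    exact (Finset.abs_sum_le_sum_abs _ _).trans (Finset.sum_le_sum fun i _ => hC2 i _)
  have hC2n : 0 ≤ ∑ i, C2 i := (abs_nonneg _).trans hL
  have h1 : |Real.cos (inner ℝ ξ x + θ) * (r ^ 2 * Laplacian.laplacian χ (r • x))| ≤
      (∑ i, C2 i) * r := by
    rw [abs_mul, abs_mul, abs_of_nonneg (sq_nonneg r)]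
    calc _ ≤ 1 * (r * ∑ i, C2 i) := by
            refine mul_le_mul (Real.abs_cos_le_one _) ?_ (by positivity) zero_le_one
            exact mul_le_mul (by nlinarith) hL (abs_nonneg _) hr0
      _ = _ := by ring
  have h2 : |∑ i, r * fderiv ℝ χ (r • x) (EuclideanSpace.basisFun (Fin n) ℝ i) *
      (-Real.sin (inner ℝ ξ x + θ) * inner ℝ ξ (EuclideanSpace.basisFun (Fin n) ℝ i))| ≤
      (∑ i, C1 i * |inner ℝ ξ (EuclideanSpace.basisFun (Fin n) ℝ i)|) * r := by
    rw [Finset.sum_mul]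
    refine (Finset.abs_sum_le_sum_abs _ _).trans (Finset.sum_le_sum fun i _ => ?_)
    have h3 := hC1 i (r • x)
    rw [Real.norm_eq_abs] at h3
    rw [abs_mul, abs_mul, abs_mul, abs_neg, abs_of_nonneg hr0]
    have h4 : |Real.sin (inner ℝ ξ x + θ)| *
        |inner ℝ ξ (EuclideanSpace.basisFun (Fin n) ℝ i)| ≤
        |inner ℝ ξ (EuclideanSpace.basisFun (Fin n) ℝ i)| :=
      mul_le_of_le_one_left (abs_nonneg _) (Real.abs_sin_le_one _)
    calc _ ≤ r * C1 i * |inner ℝ ξ (EuclideanSpace.basisFun (Fin n) ℝ i)| :=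
          mul_le_mul (mul_le_mul_of_nonneg_left h3 hr0) h4 (by positivity)
            (mul_nonneg hr0 ((abs_nonneg _).trans h3))
      _ = _ := by ring
  have e : ∀ a b c d k : ℝ, a * (-k * b) + c + 2 * d + k * (a * b) = c + 2 * d := by
    intros; ring
  rw [e]
  refine (abs_add_le _ _).trans ?_
  rw [abs_mul 2, abs_two]
  linarith

end

/-! ### Heat solutions are Gaussian convolutions -/

section
variable {n : ℕ} {v : ℝ → EuclideanSpace ℝ (Fin n) → ℝ} {v₀ : EuclideanSpace ℝ (Fin n) → ℝ}

/-- Joint continuity bounds the Laplacian on the compact set `[t/2, 2t] × tsupport ψ`, which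
dominates the time derivative; Green's identity then moves the Laplacian onto `ψ`. -/
theorem IsHeatSolution.hasDerivAt_integral_mul (hv : IsHeatSolution v v₀)
    {ψ : EuclideanSpace ℝ (Fin n) → ℝ} (hψ : ContDiff ℝ 2 ψ) (hc : HasCompactSupport ψ) {t : ℝ}
    (ht : 0 < t) :
    HasDerivAt (fun s => ∫ x, v s x * ψ x) (∫ x, v t x * Laplacian.laplacian ψ x) t := by
  rw [← integral_laplacian_mul_eq (hv.contDiff_space t ht) hψ hc]
  have hcomp : IsCompact (Icc (t / 2) (2 * t) ×ˢ tsupport ψ) := isCompact_Icc.prod hc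
  obtain ⟨K, hK⟩ := hcomp.exists_bound_of_continuousOn (hv.continuousOn_laplacian.mono
    (prod_mono (fun s hs => lt_of_lt_of_le (by positivity : 0 < t / 2) hs.1) (subset_univ _)))
  have hint : ∀ s, 0 < s → Integrable fun x => v s x * ψ x := fun s hs =>
    ((hv.contDiff_space s hs).continuous.mul hψ.continuous).integrable_of_hasCompactSupport
      hc.mul_left
  have hlap : Continuous fun x => Laplacian.laplacian (v t) x := by
    have := hv.continuousOn_laplacian.comp_continuous
      (f := fun x : EuclideanSpace ℝ (Fin n) => (t, x)) (by fun_prop) fun x => ⟨ht, mem_univ _⟩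
    exact this
  refine (hasDerivAt_integral_of_dominated_loc_of_deriv_le (s := Icc (t / 2) (2 * t))
    (F := fun s x => v s x * ψ x) (F' := fun s x => Laplacian.laplacian (v s) x * ψ x)
    (bound := fun x => K * |ψ x|) ?_ ?_ (hint t ht) ?_ ?_ ?_ ?_).2
  · exact Icc_mem_nhds (by linarith) (by linarith)
  · filter_upwards [lt_mem_nhds ht] with s hs
    exact (hint s hs).aestronglyMeasurable
  · exact (hlap.mul hψ.continuous).aestronglyMeasurable
  · refine Eventually.of_forall fun x s hs => ?_
    rw [norm_mul, Real.norm_eq_abs (ψ x)]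
    by_cases hx : x ∈ tsupport ψ
    · exact mul_le_mul_of_nonneg_right (hK (s, x) ⟨hs, hx⟩) (abs_nonneg _)
    · simp [image_eq_zero_of_notMem_tsupport hx]
  · exact ((hψ.continuous.integrable_of_hasCompactSupport hc).abs).const_mul K
  · exact Eventually.of_forall fun x s hs =>
      (hv.heat_eq s (lt_of_lt_of_le (by positivity) hs.1) x).mul_const _

theorem IsHeatSolution.integrable_mul (hv : IsHeatSolution v v₀)
    {ψ : EuclideanSpace ℝ (Fin n) → ℝ} (hψ : Continuous ψ) {C : ℝ} (hC : ∀ x, |ψ x| ≤ C)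
    {t : ℝ} (ht : 0 ≤ t) : Integrable fun x => v t x * ψ x :=
  (hv.integrable t ht).mul_bdd (c := C) hψ.aestronglyMeasurable (Eventually.of_forall hC)

theorem IsHeatSolution.continuousOn_integral_mul (hv : IsHeatSolution v v₀)
    {ψ : EuclideanSpace ℝ (Fin n) → ℝ} (hψ : Continuous ψ) {C : ℝ} (hC : ∀ x, |ψ x| ≤ C) :
    ContinuousOn (fun s => ∫ x, v s x * ψ x) (Ici 0) := by
  intro t ht
  change Tendsto _ _ _
  rw [tendsto_iff_norm_sub_tendsto_zero]
  have h := (hv.continuous_L1 t ht).const_mul C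
  rw [mul_zero] at h
  refine squeeze_zero' (Eventually.of_forall fun s => norm_nonneg _) ?_ h
  filter_upwards [self_mem_nhdsWithin] with s hs
  rw [← integral_sub (hv.integrable_mul hψ hC hs) (hv.integrable_mul hψ hC ht),
    ← integral_const_mul]
  refine norm_integral_le_of_norm_le
    (((hv.integrable s hs).sub (hv.integrable t ht)).abs.const_mul C)
    (Eventually.of_forall fun x => ?_)
  rw [← sub_mul, norm_mul, mul_comm]
  exact mul_le_mul_of_nonneg_right (hC x) (norm_nonneg _)

theorem IsHeatSolution.exists_integral_abs_le (hv : IsHeatSolution v v₀) (T : ℝ) :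
    ∃ N, ∀ s ∈ Icc 0 T, ∫ x, |v s x| ≤ N := by
  have hcont : ContinuousOn (fun s => ∫ x, |v s x|) (Icc 0 T) := by
    refine ContinuousOn.mono (s := Ici 0) ?_ fun s hs => hs.1
    intro t ht
    change Tendsto _ _ _
    rw [tendsto_iff_norm_sub_tendsto_zero]
    refine squeeze_zero' (Eventually.of_forall fun s => norm_nonneg _) ?_ (hv.continuous_L1 t ht)
    filter_upwards [self_mem_nhdsWithin] with s hs
    rw [← integral_sub (hv.integrable s hs).abs (hv.integrable t ht).abs]
    exact norm_integral_le_of_norm_le ((hv.integrable s hs).sub (hv.integrable t ht)).abs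
      (Eventually.of_forall fun x => abs_abs_sub_abs_le_abs_sub _ _)
  obtain ⟨N, hN⟩ := isCompact_Icc.exists_bound_of_continuousOn hcont
  exact ⟨N, fun s hs => (le_abs_self _).trans (hN s hs)⟩

theorem exists_contDiff_cutoff (n : ℕ) : ∃ χ : EuclideanSpace ℝ (Fin n) → ℝ,
    ContDiff ℝ 2 χ ∧ HasCompactSupport χ ∧ (∀ x, |χ x| ≤ 1) ∧ χ 0 = 1 := by
  let χ : ContDiffBump (0 : EuclideanSpace ℝ (Fin n)) := ⟨1, 2, by norm_num, by norm_num⟩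
  refine ⟨χ, χ.contDiff, χ.hasCompactSupport, fun x => ?_, ?_⟩
  · rw [abs_of_nonneg χ.nonneg]
    exact χ.le_one
  · exact χ.one_of_mem_closedBall (by simp [χ])

/-- Each Fourier mode of a heat solution decays exponentially. -/
theorem IsHeatSolution.integral_mul_cos (hv : IsHeatSolution v v₀) {T : ℝ} (hT : 0 ≤ T)
    (ξ : EuclideanSpace ℝ (Fin n)) (θ : ℝ) :
    ∫ x, v T x * Real.cos (inner ℝ ξ x + θ) =
      Real.exp (-(T * ‖ξ‖ ^ 2)) * ∫ x, v 0 x * Real.cos (inner ℝ ξ x + θ) := by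
  rcases hT.eq_or_lt with rfl | hT0
  · simp
  obtain ⟨χ, hχ, hχc, hχ1, hχ0⟩ := exists_contDiff_cutoff n
  obtain ⟨C, hC⟩ := exists_cutoff_bound hχ hχc ξ θ
  obtain ⟨N, hN⟩ := hv.exists_integral_abs_le T
  have hN0 : 0 ≤ N := (integral_nonneg fun x => abs_nonneg (v 0 x)).trans (hN 0 ⟨le_rfl, hT⟩)
  obtain ⟨κ, hκ⟩ : ∃ κ, κ = ‖ξ‖ ^ 2 := ⟨_, rfl⟩
  have hκ0 : 0 ≤ κ := by rw [hκ]; positivity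
  rw [← hκ] at hC ⊢
  let ψ : ℝ → EuclideanSpace ℝ (Fin n) → ℝ := fun r y => χ (r • y) * Real.cos (inner ℝ ξ y + θ)
  have hψ : ∀ r, ContDiff ℝ 2 (ψ r) := fun r =>
    (hχ.comp (contDiff_const_smul r)).mul (contDiff_cos_inner ξ θ)
  have hψ1 : ∀ r x, |ψ r x| ≤ 1 := fun r x => by
    rw [abs_mul]
    exact mul_le_one₀ (hχ1 _) (abs_nonneg _) (Real.abs_cos_le_one _)
  have hψc : ∀ r, 0 < r → HasCompactSupport (ψ r) := fun r hr => by
    have := hχc.comp_homeomorph (Homeomorph.smulOfNeZero r hr.ne')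
    exact HasCompactSupport.mul_right this
  have hmain : ∀ r, 0 < r → r ≤ 1 →
      |Real.exp (κ * T) * (∫ x, v T x * ψ r x) - ∫ x, v 0 x * ψ r x| ≤
        Real.exp (κ * T) * (N * (C * r)) * T := by
    intro r hr hr1
    have hC0 : 0 ≤ C * r := (abs_nonneg _).trans (hC r hr.le hr1 0)
    -- The integrating factor `exp (κ s)` would make this constant for an exact eigenfunction. The
    -- cut-off leaves a derivative of size `O(r)`, and the mean value theorem needs only continuity
    -- at time `0`, which the `L¹` continuity supplies.
    let z : ℝ → ℝ := fun s => Real.exp (κ * s) * ∫ x, v s x * ψ r x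
    have hz : ContinuousOn z (Icc 0 T) :=
      ContinuousOn.mul (by fun_prop)
        ((hv.continuousOn_integral_mul (hψ r).continuous (hψ1 r)).mono fun s hs => hs.1)
    have hd : ∀ s ∈ Ioo 0 T, HasDerivAt z
        (Real.exp (κ * s) * κ * (∫ x, v s x * ψ r x)
          + Real.exp (κ * s) * ∫ x, v s x * Laplacian.laplacian (ψ r) x) s := by
      intro s hs
      have h1 : HasDerivAt (fun s => Real.exp (κ * s)) (Real.exp (κ * s) * κ) s := by
        simpa using ((hasDerivAt_id s).const_mul κ).exp
      exact h1.mul (hv.hasDerivAt_integral_mul (hψ r) (hψc r hr) hs.1)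
    obtain ⟨s, hs, hslope⟩ := exists_hasDerivAt_eq_slope z _ hT0 hz hd
    have hlapi : Integrable fun x => v s x * Laplacian.laplacian (ψ r) x := by
      have hcl : Continuous (Laplacian.laplacian (ψ r)) := by
        refine (continuous_finsetSum Finset.univ fun i _ => (hψ r).continuous_fderiv_fderiv
          (EuclideanSpace.basisFun (Fin n) ℝ i)).congr fun x => ?_
        rw [laplacian_eq_sum_fderiv (hψ r)]
      refine hv.integrable_mul (C := C * r + κ) hcl (fun x => ?_) hs.1.le
      have h1 := hC r hr.le hr1 x
      have h2 : |κ * ψ r x| ≤ κ := by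
        rw [abs_mul, abs_of_nonneg hκ0]
        exact mul_le_of_le_one_right hκ0 (hψ1 r x)
      have h3 := abs_sub (Laplacian.laplacian (ψ r) x + κ * ψ r x) (κ * ψ r x)
      rw [add_sub_cancel_right] at h3
      exact h3.trans (add_le_add h1 h2)
    have hsum : Real.exp (κ * s) * κ * (∫ x, v s x * ψ r x)
        + Real.exp (κ * s) * ∫ x, v s x * Laplacian.laplacian (ψ r) x =
        Real.exp (κ * s) * ∫ x, v s x * (Laplacian.laplacian (ψ r) x + κ * ψ r x) := by
      have : ∫ x, v s x * (Laplacian.laplacian (ψ r) x + κ * ψ r x) =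
          (∫ x, v s x * Laplacian.laplacian (ψ r) x) + κ * ∫ x, v s x * ψ r x := by
        rw [← integral_const_mul, ← integral_add hlapi
          ((hv.integrable_mul (hψ r).continuous (hψ1 r) hs.1.le).const_mul κ)]
        congr 1
        ext x
        ring
      rw [this]
      ring
    have hbd : |∫ x, v s x * (Laplacian.laplacian (ψ r) x + κ * ψ r x)| ≤ N * (C * r) := by
      rw [← Real.norm_eq_abs]
      refine (norm_integral_le_of_norm_le ((hv.integrable s hs.1.le).abs.mul_const (C * r))
        (Eventually.of_forall fun x => ?_)).trans ?_
      · rw [norm_mul]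
        exact mul_le_mul_of_nonneg_left (hC r hr.le hr1 x) (norm_nonneg _)
      · rw [integral_mul_const]
        exact mul_le_mul_of_nonneg_right (hN s ⟨hs.1.le, hs.2.le⟩) hC0
    rw [hsum, sub_zero, eq_div_iff hT0.ne'] at hslope
    have hz0 : z 0 = ∫ x, v 0 x * ψ r x := by simp [z]
    rw [← hz0]
    change |z T - z 0| ≤ _
    rw [← hslope, abs_mul, abs_mul, abs_of_pos hT0, abs_of_pos (Real.exp_pos _)]
    refine mul_le_mul_of_nonneg_right (mul_le_mul ?_ hbd (abs_nonneg _) (Real.exp_pos _).le) hT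
    exact Real.exp_le_exp.mpr (mul_le_mul_of_nonneg_left hs.2.le hκ0)
  -- Removing the cut-off, `r = 1 / (k + 1) → 0`, by dominated convergence.
  have hlim : ∀ s, 0 ≤ s → Tendsto (fun k : ℕ => ∫ x, v s x * ψ (1 / ((k : ℝ) + 1)) x) atTop
      (𝓝 (∫ x, v s x * Real.cos (inner ℝ ξ x + θ))) := by
    intro s hs
    refine tendsto_integral_of_dominated_convergence (fun x => |v s x|)
      (fun k => (hv.integrable_mul (hψ _).continuous (hψ1 _) hs).aestronglyMeasurable)
      (hv.integrable s hs).abs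
      (fun k => Eventually.of_forall fun x => ?_) (Eventually.of_forall fun x => ?_)
    · rw [norm_mul]
      exact mul_le_of_le_one_right (norm_nonneg _) (hψ1 _ x)
    · have h1 : Tendsto (fun k : ℕ => χ ((1 / ((k : ℝ) + 1)) • x)) atTop (𝓝 1) := by
        have := (tendsto_one_div_add_atTop_nhds_zero_nat (𝕜 := ℝ)).smul_const x
        rw [zero_smul] at this
        have h2 := (hχ.continuous.tendsto 0).comp this
        rwa [hχ0] at h2
      have := (h1.mul_const (Real.cos (inner ℝ ξ x + θ))).const_mul (v s x)
      rwa [one_mul] at this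
  have hzero : Tendsto (fun k : ℕ => Real.exp (κ * T) * (N * (C * (1 / ((k : ℝ) + 1)))) * T) atTop
      (𝓝 0) := by
    have := ((((tendsto_one_div_add_atTop_nhds_zero_nat (𝕜 := ℝ)).const_mul C).const_mul
      N).const_mul (Real.exp (κ * T))).mul_const T
    simpa using this
  have hfin : |Real.exp (κ * T) * (∫ x, v T x * Real.cos (inner ℝ ξ x + θ)) -
      ∫ x, v 0 x * Real.cos (inner ℝ ξ x + θ)| ≤ 0 := by
    refine le_of_tendsto_of_tendsto' (((hlim T hT).const_mul _).sub (hlim 0 le_rfl)).abs hzero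
      fun k => hmain _ (by positivity) ?_
    rw [div_le_one (by positivity)]
    linarith [(Nat.cast_nonneg k : (0 : ℝ) ≤ k)]
  have heq := sub_eq_zero.mp (abs_nonpos_iff.mp hfin)
  rw [← heq, ← mul_assoc, ← Real.exp_add]
  simp [mul_comm]

/-- Fourier transform of a heat solution. -/
theorem IsHeatSolution.integral_mul_cexp (hv : IsHeatSolution v v₀) {T : ℝ} (hT : 0 ≤ T)
    (ξ : EuclideanSpace ℝ (Fin n)) :
    ∫ x, v T x • Complex.exp (inner ℝ x ξ * Complex.I) =
      Complex.exp (-(2 * T * ‖ξ‖ ^ 2 : ℝ) / 2) *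
        ∫ x, v₀ x • Complex.exp (inner ℝ x ξ * Complex.I) := by
  -- The phases `0` and `-π/2` produce the cosine and sine parts.
  have hexp : ∀ x, Complex.exp (inner ℝ x ξ * Complex.I) =
      (Real.cos (inner ℝ ξ x + 0) : ℝ) +
        (Real.cos (inner ℝ ξ x + -(Real.pi / 2)) : ℝ) * Complex.I := by
    intro x
    rw [add_zero, ← sub_eq_add_neg, Real.cos_sub_pi_div_two, Complex.exp_mul_I, real_inner_comm]
    push_cast
    rfl
  have hsplit : ∀ s, 0 ≤ s → ∫ x, v s x • Complex.exp (inner ℝ x ξ * Complex.I) =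
      ((∫ x, v s x * Real.cos (inner ℝ ξ x + 0) : ℝ) : ℂ) +
        ((∫ x, v s x * Real.cos (inner ℝ ξ x + -(Real.pi / 2)) : ℝ) : ℂ) * Complex.I := by
    intro s hs
    have hi : ∀ θ, Integrable fun x => v s x * Real.cos (inner ℝ ξ x + θ) := fun θ =>
      hv.integrable_mul (contDiff_cos_inner ξ θ).continuous (C := 1)
        (fun x => Real.abs_cos_le_one _) hs
    rw [← integral_complex_ofReal, ← integral_complex_ofReal, ← integral_mul_const,
      ← integral_add (hi 0).ofReal ((hi _).ofReal.mul_const _)]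
    congr 1
    ext x
    rw [hexp, Complex.real_smul]
    push_cast
    ring
  have h0 : ∫ x, v₀ x • Complex.exp (inner ℝ x ξ * Complex.I) =
      ∫ x, v 0 x • Complex.exp (inner ℝ x ξ * Complex.I) := by
    refine integral_congr_ae ?_
    filter_upwards [hv.initial] with x hx
    rw [hx]
  rw [h0, hsplit T hT, hsplit 0 le_rfl, hv.integral_mul_cos hT, hv.integral_mul_cos hT]
  have : Complex.exp (-(2 * T * ‖ξ‖ ^ 2 : ℝ) / 2) = (Real.exp (-(T * ‖ξ‖ ^ 2)) : ℝ) := by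
    push_cast
    congr 1
    ring
  rw [this]
  push_cast
  ring

/-- A heat solution starting from a nonnegative integrable function stays nonnegative and is the
density of the convolution of the initial law with a Gaussian. -/
theorem IsHeatSolution.nonneg_and_withDensity_eq (hv : IsHeatSolution v v₀)
    (h0i : Integrable v₀) (h0 : ∀ᵐ x, 0 ≤ v₀ x) {T : ℝ} (hT : 0 ≤ T) :
    (∀ᵐ x, 0 ≤ v T x) ∧ (volume.withDensity fun x => ENNReal.ofReal (v T x)) =
      (volume.withDensity fun x => ENNReal.ofReal (v₀ x)) ∗ gaussianLaw n (2 * T) := by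
  have hi := hv.integrable T hT
  have hip : Integrable fun x => max (v T x) 0 := hi.pos_part
  have hin : Integrable fun x => max (-v T x) 0 := hi.neg_part
  have f1 := isFiniteMeasure_withDensity_ofReal' hip
  have f2 := isFiniteMeasure_withDensity_ofReal' hin
  have f3 := isFiniteMeasure_withDensity_ofReal' h0i
  have hexpi : ∀ (ξ : EuclideanSpace ℝ (Fin n)) {f : EuclideanSpace ℝ (Fin n) → ℝ},
      Integrable f → Integrable fun x => f x • Complex.exp (inner ℝ x ξ * Complex.I) := by
    intro ξ f hf
    have := hf.ofReal (𝕜 := ℂ)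
    refine (this.mul_bdd (c := 1)
      (g := fun x => Complex.exp (inner ℝ x ξ * Complex.I)) ?_ ?_).congr ?_
    · exact (by fun_prop : Continuous fun x : EuclideanSpace ℝ (Fin n) =>
        Complex.exp (inner ℝ x ξ * Complex.I)).aestronglyMeasurable
    · exact Eventually.of_forall fun x => (Complex.norm_exp_ofReal_mul_I _).le
    · exact Eventually.of_forall fun x => by simp [Complex.real_smul]
  -- The sign of `v T` is not yet known, so the Fourier identity is written between positive
  -- measures, with the negative part moved to the other side.
  have hmeas : (volume.withDensity fun x => ENNReal.ofReal (max (v T x) 0)) =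
      (volume.withDensity fun x => ENNReal.ofReal (max (-v T x) 0)) +
        (volume.withDensity fun x => ENNReal.ofReal (v₀ x)) ∗ gaussianLaw n (2 * T) := by
    refine Measure.ext_of_charFun (funext fun ξ => ?_)
    have hbi : ∀ (m : Measure (EuclideanSpace ℝ (Fin n))) [IsFiniteMeasure m],
        Integrable (fun x => Complex.exp (inner ℝ x ξ * Complex.I)) m := fun m _ =>
      Integrable.of_bound (by fun_prop) 1
        (Eventually.of_forall fun x => (Complex.norm_exp_ofReal_mul_I _).le)
    have hadd : charFun ((volume.withDensity fun x => ENNReal.ofReal (max (-v T x) 0)) +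
        (volume.withDensity fun x => ENNReal.ofReal (v₀ x)) ∗ gaussianLaw n (2 * T)) ξ =
        charFun (volume.withDensity fun x => ENNReal.ofReal (max (-v T x) 0)) ξ +
        charFun ((volume.withDensity fun x => ENNReal.ofReal (v₀ x)) ∗ gaussianLaw n (2 * T)) ξ := by
      simp only [charFun_apply]
      exact integral_add_measure (hbi _) (hbi _)
    rw [hadd, charFun_conv, charFun_gaussianLaw (by positivity), charFun_apply, charFun_apply,
      charFun_apply,
      integral_withDensity_ofReal hip (Eventually.of_forall fun x => le_max_right _ _),
      integral_withDensity_ofReal hin (Eventually.of_forall fun x => le_max_right _ _),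
      integral_withDensity_ofReal h0i h0, mul_comm, ← hv.integral_mul_cexp hT, ← sub_eq_iff_eq_add',
      ← integral_sub (hexpi ξ hip) (hexpi ξ hin)]
    congr 1
    ext x
    rw [← sub_smul]
    congr 1
    rcases le_total 0 (v T x) with h | h
    · rw [max_eq_left h, max_eq_right (by linarith), sub_zero]
    · rw [max_eq_right h, max_eq_left (by linarith)]
      ring
  have hnonneg : ∀ᵐ x, 0 ≤ v T x := by
    -- The negative part is dominated by the positive part, but the two are never both nonzero at a
    -- point; hence the negative part vanishes.
    have hle : (volume.withDensity fun x => ENNReal.ofReal (max (-v T x) 0)) ≤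
        volume.withDensity fun x => ENNReal.ofReal (max (v T x) 0) := by
      rw [hmeas]
      exact Measure.le_add_right le_rfl
    have h1 := ae_le_of_forall_setLIntegral_le_of_sigmaFinite₀
      (f := fun x => ENNReal.ofReal (max (-v T x) 0)) (g := fun x => ENNReal.ofReal (max (v T x) 0))
      hin.aemeasurable.ennreal_ofReal fun s hs _ => by
        rw [← withDensity_apply _ hs, ← withDensity_apply _ hs]
        exact hle s
    filter_upwards [h1] with x hx
    rw [ENNReal.ofReal_le_ofReal_iff (le_max_right _ _)] at hx
    by_contra! hneg
    rw [max_eq_left (by linarith), max_eq_right hneg.le] at hx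
    linarith
  refine ⟨hnonneg, ?_⟩
  have e1 : (volume.withDensity fun x => ENNReal.ofReal (max (-v T x) 0)) = 0 := by
    rw [withDensity_congr_ae (g := 0), withDensity_zero]
    filter_upwards [hnonneg] with x hx
    simp [hx]
  have e2 : (fun x => ENNReal.ofReal (max (v T x) 0)) = fun x => ENNReal.ofReal (v T x) := by
    ext x
    simp [ENNReal.ofReal_max]
  rw [← e2, hmeas, e1, zero_add]

end

/-! ### Second moments and Gaussian reference measures -/

section
variable {n : ℕ}

theorem integral_norm_sq_conv_gaussianLaw {m : Measure (EuclideanSpace ℝ (Fin n))}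
    [IsProbabilityMeasure m] (hm : Integrable (fun x => ‖x‖ ^ 2) m) {τ : ℝ} (hτ : 0 ≤ τ) :
    Integrable (fun x => ‖x‖ ^ 2) (m ∗ gaussianLaw n τ) ∧
      ∫ x, ‖x‖ ^ 2 ∂(m ∗ gaussianLaw n τ) = (∫ x, ‖x‖ ^ 2 ∂m) + n * τ := by
  have hγ := integrable_norm_sq_gaussianLaw (n := n) τ
  have hi : Integrable (fun x => ‖x‖ ^ 2) (m ∗ gaussianLaw n τ) := by
    rw [Measure.conv, integrable_map_measure (by fun_prop) (by fun_prop)]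
    refine (((hm.comp_fst (gaussianLaw n τ)).add (hγ.comp_snd m)).const_mul 2).mono' (by fun_prop)
      (Eventually.of_forall fun p => ?_)
    simp only [Function.comp_apply, Pi.add_apply]
    rw [Real.norm_eq_abs, abs_of_nonneg (sq_nonneg _)]
    have := norm_add_le p.1 p.2
    nlinarith [sq_nonneg (‖p.1‖ - ‖p.2‖), norm_nonneg (p.1 + p.2)]
  refine ⟨hi, ?_⟩
  have hid : Integrable (fun y : EuclideanSpace ℝ (Fin n) => y) (gaussianLaw n τ) := by
    rw [gaussianLaw, integrable_map_measure (by fun_prop) (by fun_prop)]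
    exact IsGaussian.integrable_id.smul (√τ)
  have hmean : ∫ y, y ∂(gaussianLaw n τ) = 0 := by
    rw [gaussianLaw, integral_map (by fun_prop) (by fun_prop), integral_smul,
      integral_id_stdGaussian, smul_zero]
  rw [integral_conv hi]
  have e : ∀ x : EuclideanSpace ℝ (Fin n),
      ∫ y, ‖x + y‖ ^ 2 ∂(gaussianLaw n τ) = ‖x‖ ^ 2 + n * τ := by
    intro x
    simp only [norm_add_sq_real]
    have h1 : Integrable (fun y => 2 * inner ℝ x y) (gaussianLaw n τ) :=
      (hid.const_inner x).const_mul 2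
    refine (integral_add ((integrable_const (‖x‖ ^ 2)).add h1) hγ).trans ?_
    rw [integral_add' (integrable_const _) h1, integral_const_mul, integral_inner hid, hmean, integral_norm_sq_gaussianLaw hτ]
    simp
  simp only [e]
  rw [integral_add hm (integrable_const _)]
  simp

theorem log_gaussianDensity {σ : ℝ} (hσ : 0 < σ) (x : EuclideanSpace ℝ (Fin n)) :
    Real.log (gaussianDensity σ x) =
      -((n : ℝ) / 2) * (Real.log (2 * Real.pi) + Real.log σ) - ‖x‖ ^ 2 / (2 * σ) := by
  rw [gaussianDensity, Real.log_mul (by positivity) (Real.exp_pos _).ne', Real.log_exp,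
    Real.log_rpow (by positivity), one_div, Real.log_inv, Real.log_mul (by positivity) hσ.ne']
  ring

theorem relEntropyIntegrand_gaussianDensity {σ : ℝ} (hσ : 0 < σ)
    (f : EuclideanSpace ℝ (Fin n) → ℝ) (x : EuclideanSpace ℝ (Fin n)) :
    relEntropyIntegrand f (gaussianDensity σ) x = f x * Real.log (f x) +
      ((n : ℝ) / 2 * (Real.log (2 * Real.pi) + Real.log σ) * f x
        + 1 / (2 * σ) * (‖x‖ ^ 2 * f x)) := by
  rw [relEntropyIntegrand]
  rcases eq_or_ne (f x) 0 with h | h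
  · simp [h]
  · rw [Real.log_div h (gaussianDensity_pos hσ x).ne', log_gaussianDensity hσ]
    ring

theorem integrable_relEntropyIntegrand_gaussianDensity {σ : ℝ} (hσ : 0 < σ)
    {f : EuclideanSpace ℝ (Fin n) → ℝ} (hf : Integrable f)
    (hf2 : Integrable fun x => ‖x‖ ^ 2 * f x) (hent : HasFiniteEntropy f) :
    Integrable (relEntropyIntegrand f (gaussianDensity σ)) := by
  rw [funext (relEntropyIntegrand_gaussianDensity hσ f)]
  exact Integrable.add hent ((hf.const_mul _).add (hf2.const_mul _))

/-- The logarithm of a ratio of two centred isotropic Gaussians is a constant plus a multiple of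
`‖x‖²`, so only the mass and second moment of `f` enter. -/
theorem relEntropy_gaussianDensity_change {σ₁ σ₂ : ℝ} (h₁ : 0 < σ₁) (h₂ : 0 < σ₂)
    {f : EuclideanSpace ℝ (Fin n) → ℝ} (hf : Integrable f) (hf1 : ∫ x, f x = 1)
    (hf2 : Integrable fun x => ‖x‖ ^ 2 * f x)
    (hi : Integrable (relEntropyIntegrand f (gaussianDensity σ₁))) :
    Integrable (relEntropyIntegrand f (gaussianDensity σ₂)) ∧
      relEntropy f (gaussianDensity σ₂) = relEntropy f (gaussianDensity σ₁) +
        (n : ℝ) / 2 * (Real.log σ₂ - Real.log σ₁) +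
        (∫ x, ‖x‖ ^ 2 * f x) / 2 * (1 / σ₂ - 1 / σ₁) := by
  have e : relEntropyIntegrand f (gaussianDensity σ₂) = fun x =>
      relEntropyIntegrand f (gaussianDensity σ₁) x +
        ((n : ℝ) / 2 * (Real.log σ₂ - Real.log σ₁) * f x +
          1 / 2 * (1 / σ₂ - 1 / σ₁) * (‖x‖ ^ 2 * f x)) := by
    ext x
    rw [relEntropyIntegrand_gaussianDensity h₁, relEntropyIntegrand_gaussianDensity h₂]
    field_simp
    ring
  have hi2 : Integrable fun x => (n : ℝ) / 2 * (Real.log σ₂ - Real.log σ₁) * f x +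
      1 / 2 * (1 / σ₂ - 1 / σ₁) * (‖x‖ ^ 2 * f x) := (hf.const_mul _).add (hf2.const_mul _)
  rw [relEntropy, relEntropy, e]
  refine ⟨hi.add hi2, ?_⟩
  rw [integral_add hi hi2, integral_add (hf.const_mul _) (hf2.const_mul _), integral_const_mul,
    integral_const_mul, hf1]
  ring

/-- A vanishing second moment would concentrate the mass at the origin, a null set in dimension at
least one. -/
theorem IsNormalizedDensity.second_moment_pos (hn : 1 ≤ n) {E₀ : ℝ}
    {f : EuclideanSpace ℝ (Fin n) → ℝ} (hf : IsNormalizedDensity f E₀) : 0 < E₀ := by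
  have hnn : ∀ᵐ x, 0 ≤ ‖x‖ ^ 2 * f x := by
    filter_upwards [hf.nonneg] with x hx
    positivity
  have h0 : 0 ≤ E₀ := hf.second_moment_eq ▸ integral_nonneg_of_ae hnn
  refine h0.lt_of_ne fun h => ?_
  have h1 := hf.second_moment_eq
  rw [← h, integral_eq_zero_iff_of_nonneg_ae hnn hf.integrable_second_moment] at h1
  have : Nonempty (Fin n) := ⟨⟨0, hn⟩⟩
  have hne : ∀ᵐ x : EuclideanSpace ℝ (Fin n), x ≠ 0 := by
    rw [ae_iff]
    simp
  have h2 : f =ᵐ[volume] 0 := by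
    filter_upwards [h1, hne] with x hx hx0
    simpa [hx0] using hx
  have h3 := hf.mass_eq_one
  rw [integral_congr_ae h2] at h3
  simp at h3

theorem relEntropy_nonneg {f g : EuclideanSpace ℝ (Fin n) → ℝ} (hf : Integrable f)
    (hf0 : ∀ᵐ x, 0 ≤ f x) (hg : Integrable g) (hg0 : ∀ᵐ x, 0 < g x)
    (hfg : ∫ x, f x = ∫ x, g x) (hi : Integrable (relEntropyIntegrand f g)) :
    0 ≤ relEntropy f g := by
  have h : ∫ x, (f x - g x) ≤ relEntropy f g := by
    refine integral_mono_ae (hf.sub hg) hi ?_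
    filter_upwards [hf0, hg0] with x h1 h2
    exact sub_le_mul_log_div h1 h2
  rwa [integral_sub hf hg, hfg, sub_self] at h

end

/-! ### The entropy bound along the heat flow -/

section
variable {n : ℕ} {E₀ : ℝ} {v M : ℝ → EuclideanSpace ℝ (Fin n) → ℝ}
  {v₀ : EuclideanSpace ℝ (Fin n) → ℝ}

theorem IsHeatSolution.ae_eq_gaussianDensity {s t : ℝ} (hs : 0 < s) (ht : 0 ≤ t)
    (hM : IsHeatSolution M (gaussianDensity s)) : M t =ᵐ[volume] gaussianDensity (s + 2 * t) := by
  have hst : 0 < s + 2 * t := by positivity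
  obtain ⟨h1, h2⟩ := hM.nonneg_and_withDensity_eq (integrable_gaussianDensity hs)
    (Eventually.of_forall fun x => (gaussianDensity_pos hs x).le) ht
  rw [withDensity_gaussianDensity hs, gaussianLaw_conv hs.le (by positivity),
    ← withDensity_gaussianDensity hst] at h2
  have hfin : ∫⁻ x, ENNReal.ofReal (M t x) ≠ ⊤ :=
    ((hasFiniteIntegral_iff_ofReal h1).mp (hM.integrable t ht).hasFiniteIntegral).ne
  rw [withDensity_eq_iff (hM.integrable t ht).aemeasurable.ennreal_ofReal
    (integrable_gaussianDensity hst).aemeasurable.ennreal_ofReal hfin] at h2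
  filter_upwards [h1, h2] with x hx1 hx2
  exact (ENNReal.ofReal_eq_ofReal_iff hx1 (gaussianDensity_pos hst x).le).mp hx2

/-- Mass and second moment of a heat solution. -/
theorem IsHeatSolution.moments (hv : IsHeatSolution v v₀) (hv₀ : IsNormalizedDensity v₀ E₀)
    {t : ℝ} (ht : 0 ≤ t) :
    ∫ x, v t x = 1 ∧ (Integrable fun x => ‖x‖ ^ 2 * v t x) ∧
      ∫ x, ‖x‖ ^ 2 * v t x = E₀ + n * (2 * t) := by
  obtain ⟨h1, h2⟩ := hv.nonneg_and_withDensity_eq hv₀.integrable hv₀.nonneg ht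
  have hi := hv.integrable t ht
  have hfin := isFiniteMeasure_withDensity_ofReal' hv₀.integrable
  have hprob : IsProbabilityMeasure (volume.withDensity fun x => ENNReal.ofReal (v₀ x)) := by
    have h := integral_withDensity_ofReal hv₀.integrable hv₀.nonneg fun _ => (1 : ℝ)
    simp only [integral_const, smul_eq_mul, mul_one, hv₀.mass_eq_one] at h
    constructor
    rw [← ENNReal.toReal_eq_one_iff]
    exact h
  have hm : Integrable (fun x => ‖x‖ ^ 2) (volume.withDensity fun x => ENNReal.ofReal (v₀ x)) := by
    rw [integrable_withDensity_ofReal_iff hv₀.integrable hv₀.nonneg]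
    simpa only [smul_eq_mul, mul_comm] using hv₀.integrable_second_moment
  obtain ⟨h3, h4⟩ := integral_norm_sq_conv_gaussianLaw hm (τ := 2 * t) (by positivity)
  rw [← h2] at h3 h4
  rw [integrable_withDensity_ofReal_iff hi h1] at h3
  rw [integral_withDensity_ofReal hi h1, integral_withDensity_ofReal hv₀.integrable hv₀.nonneg] at h4
  refine ⟨?_, ?_, ?_⟩
  · have h := integral_withDensity_ofReal hi h1 fun _ => (1 : ℝ)
    rw [h2] at h
    simpa using h.symm
  · simpa only [smul_eq_mul, mul_comm] using h3
  · have h5 := hv₀.second_moment_eq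
    simp only [smul_eq_mul] at h4
    simp only [mul_comm] at h4 h5 ⊢
    rw [h4, h5]

theorem relEntropy_heat_bound (hn : 1 ≤ n) (hv₀ : IsNormalizedDensity v₀ E₀)
    (hent : HasFiniteEntropy v₀) (hv : IsHeatSolution v v₀)
    (hM : IsHeatSolution M (gaussianDensity (E₀ / n))) {t : ℝ} (ht : 0 ≤ t) :
    Integrable (relEntropyIntegrand (v t) (M t)) ∧
      relEntropy (v t) (M t) ≤
        -((n : ℝ) / 2) * Real.log (1 -
          (1 - Real.exp (-(2 / (n : ℝ)) * relEntropy v₀ (gaussianDensity (E₀ / n)))) *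
            (E₀ / (E₀ + 2 * n * t))) := by
  have hn0 : (0 : ℝ) < n := by exact_mod_cast hn
  have hE := hv₀.second_moment_pos hn
  obtain ⟨s, hs⟩ : ∃ s, s = E₀ / n := ⟨_, rfl⟩
  have hs0 : 0 < s := by rw [hs]; positivity
  have hEs : E₀ = n * s := by rw [hs]; field_simp
  rw [← hs] at hM ⊢
  obtain ⟨H, hH⟩ : ∃ H, H = relEntropy v₀ (gaussianDensity s) := ⟨_, rfl⟩
  rw [← hH]
  -- `M_σ` has the same Shannon entropy as `v₀`, so `H(v₀|M_σ)` reduces to the second-moment term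
  -- `(n/2)(s/σ - 1)`.
  obtain ⟨σ, hσ⟩ : ∃ σ, σ = s * Real.exp (-(2 / (n : ℝ)) * H) := ⟨_, rfl⟩
  have hσ0 : 0 < σ := by rw [hσ]; positivity
  have hM' := hM.ae_eq_gaussianDensity hs0 ht
  have hcongr : relEntropyIntegrand (v t) (M t) =ᵐ[volume]
      relEntropyIntegrand (v t) (gaussianDensity (s + 2 * t)) := by
    filter_upwards [hM'] with x hx
    rw [relEntropyIntegrand, relEntropyIntegrand, hx]
  have hi0 := integrable_relEntropyIntegrand_gaussianDensity hs0 hv₀.integrable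
    hv₀.integrable_second_moment hent
  have hlogσ : Real.log σ = Real.log s - 2 / n * H := by
    rw [hσ, Real.log_mul hs0.ne' (Real.exp_pos _).ne', Real.log_exp]
    ring
  have harg : 1 - (1 - Real.exp (-(2 / (n : ℝ)) * H)) * (E₀ / (E₀ + 2 * n * t)) =
      (σ + 2 * t) / (s + 2 * t) := by
    have h1 : s + 2 * t ≠ 0 := by positivity
    have h2 : n * s + 2 * n * t ≠ 0 := by positivity
    rw [hσ, hEs]
    field_simp
    ring
  rw [integrable_congr hcongr, relEntropy, integral_congr_ae hcongr, harg,
    Real.log_div (by positivity) (by positivity)]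
  change _ ∧ relEntropy (v t) (gaussianDensity (s + 2 * t)) ≤ _
  -- At `t = 0` there is no noise and `v 0` is only known almost everywhere; there the bound is an
  -- equality.
  rcases ht.eq_or_lt with rfl | ht0
  · have h0 : relEntropyIntegrand (v 0) (gaussianDensity (s + 2 * 0)) =ᵐ[volume]
        relEntropyIntegrand v₀ (gaussianDensity s) := by
      filter_upwards [hv.initial] with x hx
      rw [relEntropyIntegrand, relEntropyIntegrand, hx, mul_zero, add_zero]
    rw [integrable_congr h0, relEntropy, integral_congr_ae h0]
    refine ⟨hi0, ?_⟩
    change relEntropy v₀ (gaussianDensity s) ≤ _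
    rw [← hH, mul_zero, add_zero, add_zero, hlogσ]
    refine le_of_eq ?_
    field_simp
    ring
  · obtain ⟨hm1, hm2, hm3⟩ := hv.moments hv₀ ht
    obtain ⟨hv1, hv2⟩ := hv.nonneg_and_withDensity_eq hv₀.integrable hv₀.nonneg ht
    have hvc : Continuous (v t) := (hv.contDiff_space t ht0).continuous
    -- Continuity upgrades almost-everywhere nonnegativity: the set where `v t` is negative is open
    -- and null, hence empty.
    have hvn : ∀ x, 0 ≤ v t x := by
      have hopen : IsOpen {x | v t x < 0} := isOpen_lt hvc continuous_const
      have hz : volume {x | v t x < 0} = 0 := by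
        rw [ae_iff] at hv1
        simpa using hv1
      have := (hopen.measure_eq_zero_iff volume).mp hz
      intro x
      by_contra! hx
      exact (this ▸ hx : x ∈ (∅ : Set _))
    obtain ⟨hc1, hc2⟩ := relEntropy_gaussianDensity_change hs0 hσ0 hv₀.integrable
      hv₀.mass_eq_one hv₀.integrable_second_moment hi0
    obtain ⟨hd1, hd2⟩ := relEntropy_conv_gaussianLaw_le hσ0 (by positivity : 0 < 2 * t)
      hv₀.integrable hv₀.nonneg hv₀.mass_eq_one hc1 hvc (hv.integrable t ht) hvn hv2
    obtain ⟨he1, he2⟩ := relEntropy_gaussianDensity_change (by positivity : 0 < σ + 2 * t)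
      (by positivity : 0 < s + 2 * t) (hv.integrable t ht) hm1 hm2 hd1
    refine ⟨he1, ?_⟩
    rw [hv₀.second_moment_eq, ← hH, hlogσ, hEs] at hc2
    have hc3 : relEntropy v₀ (gaussianDensity σ) = n / 2 * (s / σ - 1) := by
      rw [hc2]
      field_simp
      ring
    rw [hc3] at hd2
    rw [he2, hm3, hEs]
    -- The contracted entropy cancels the second-moment cost of returning to `M_{s+2t}`; only the
    -- difference of logarithms survives.
    have h5 : σ / (σ + 2 * t) * (n / 2 * (s / σ - 1)) + (n * s + n * (2 * t)) / 2 *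
        (1 / (s + 2 * t) - 1 / (σ + 2 * t)) = 0 := by
      have h1 : s + 2 * t ≠ 0 := by positivity
      have h2 : σ + 2 * t ≠ 0 := by positivity
      field_simp
      ring
    linarith

end

theorem mainTheorem2 (n : ℕ) (hn : 1 ≤ n) (E₀ : ℝ)
    (v₀ : EuclideanSpace ℝ (Fin n) → ℝ)
    (hv₀ : IsNormalizedDensity v₀ E₀) (hent : HasFiniteEntropy v₀)
    (v M : ℝ → EuclideanSpace ℝ (Fin n) → ℝ)
    (hv : IsHeatSolution v v₀)
    (hM : IsHeatSolution M (gaussianDensity (E₀ / n))) :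
    (∀ t : ℝ, 0 ≤ t →
      Integrable (relEntropyIntegrand (v t) (M t)) ∧
      relEntropy (v t) (M t) ≤
        -((n : ℝ) / 2) * Real.log (1 -
          (1 - Real.exp (-(2 / (n : ℝ)) * relEntropy v₀ (gaussianDensity (E₀ / n)))) *
            (E₀ / (E₀ + 2 * n * t)))) ∧
    Tendsto (fun t => relEntropy (v t) (M t)) atTop (𝓝 0) := by
  have hn0 : (0 : ℝ) < n := by exact_mod_cast hn
  have hE := hv₀.second_moment_pos hn
  have hs0 : 0 < E₀ / n := by positivity
  refine ⟨fun t ht => relEntropy_heat_bound hn hv₀ hent hv hM ht, ?_⟩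
  obtain ⟨k, hk⟩ : ∃ k, k = 1 - Real.exp (-(2 / (n : ℝ)) *
    relEntropy v₀ (gaussianDensity (E₀ / n))) := ⟨_, rfl⟩
  have hlim : Tendsto (fun t : ℝ => -((n : ℝ) / 2) *
      Real.log (1 - k * (E₀ / (E₀ + 2 * n * t)))) atTop (𝓝 0) := by
    have h1 : Tendsto (fun t : ℝ => E₀ + 2 * n * t) atTop atTop :=
      tendsto_atTop_add_const_left _ _ (tendsto_id.const_mul_atTop (by positivity))
    have h2 := ((h1.const_div_atTop E₀).const_mul k).const_sub 1
    rw [mul_zero, sub_zero] at h2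
    have h3 := (h2.log one_ne_zero).const_mul (-((n : ℝ) / 2))
    rwa [Real.log_one, mul_zero] at h3
  refine tendsto_of_tendsto_of_tendsto_of_le_of_le' tendsto_const_nhds hlim ?_ ?_
  · filter_upwards [eventually_ge_atTop 0] with t ht
    have hst : 0 < E₀ / n + 2 * t := by positivity
    have hM' := hM.ae_eq_gaussianDensity hs0 ht
    refine relEntropy_nonneg (hv.integrable t ht)
      (hv.nonneg_and_withDensity_eq hv₀.integrable hv₀.nonneg ht).1 (hM.integrable t ht) ?_ ?_
      (relEntropy_heat_bound hn hv₀ hent hv hM ht).1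
    · filter_upwards [hM'] with x hx
      rw [hx]
      exact gaussianDensity_pos hst x
    · rw [(hv.moments hv₀ ht).1, integral_congr_ae hM', integral_gaussianDensity hst]
  · filter_upwards [eventually_ge_atTop 0] with t ht
    rw [hk]
    exact (relEntropy_heat_bound hn hv₀ hent hv hM ht).2
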